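/- Let $s=T_{2,0}(1)$ denote the unique positive root of $s=\coth s$. For $T>0$ and a smooth positive function $f$ on $[0,T]$, consider the rotationally symmetric metric $g=f(t)^2(dt^2+d\theta^2)$ on the cylinder $\Sigma=[0,T]\times\mathbb S^1$, with $\mathbb S^1=\mathbb R/2\pi\mathbb Z$. Let $0=\sigma_0(g)<\sigma_1(g)\le\sigma_2(g)\le\cdots$ be its Steklov eigenvalues, that is, the eigenvalues, repeated according to multiplicity, of the Dirichlet-to-Neumann problem $\Delta_g u=0$ in $\Sigma$, $\partial u/\partial n=\sigma u$ on $\partial\Sigma$ ($n$ the outward unit normal), and let $\tilde\sigma_k(g)=\sigma_k(g)\,L_g(\partial\Sigma)$, where $L_g(\partial\Sigma)$ is the length of the boundary. Let $n\ge 1$ be an integer and define the critical $n$-catenoid to be the surface in $\mathbb R^3$ parametrized by $$(t,\theta)\mapsto\bigl(nt,\ \cosh(nt)\cos(n\theta),\ \cosh(nt)\sin(n\theta)\bigr),\qquad t\in[-s/n,\,s/n],\ \theta\in\mathbb S^1,$$ and let $X_n(t,\theta)$, $t\in[0,2s/n]$, be the same map with $t$ replaced by $t-s/n$. Then: 1.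 The maximum of $\tilde\sigma_{2n-1}(g)$ over all $T>0$ and all metrics $g=f(t)^2(dt^2+d\theta^2)$ on $[0,T]\times\mathbb S^1$ exists and equals $4\pi n/s$. A metric attains it if and only if $T=2s/n$ and $f(0)=f(T)$. 2. The maximum is attained by the critical $n$-catenoid: the metric induced by $X_n$ on $[0,2s/n]\times\mathbb S^1$ is of the form $f(t)^2(dt^2+d\theta^2)$ and satisfies $\tilde\sigma_{2n-1}=4\pi n/s$. 3. $X_n$ is a minimal immersion with free boundary in a ball $B$ centred at the origin: it maps the interior of the cylinder into the interior of $B$ and the boundary into $\partial B$, and the surface meets $\partial B$ orthogonally along its boundary. It is an $n$-fold cover of the critical catenoid $\{(t,\cosh t\cos\theta,\cosh t\sin\theta): t\in[-s,s],\ \theta\in\mathbb S^1\}$: its image is that set, and each point of the image has exactly $n$ preimages. 4. For every maximizing metric, the three coordinate functions of $X_n$ are Steklov eigenfunctions for $\sigma_{2n-1}$ and form a basis of the eigenspace of $\sigma_{2n-1}$. -/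

import Mathlib

open Real Set
open scoped ContDiff InnerProductSpace

noncomputable section

namespace Steklov

/-- The cylinder `[0,T] × S¹`, with `S¹ = ℝ / 2πℤ`. -/
abbrev Cylinder (T : ℝ) : Type := Icc (0 : ℝ) T × Real.Angle

/-- A map on the cylinder, written in the coordinates `(t, θ)`. It is `2π`-periodic in `θ`; only its
values at `t ∈ [0,T]` are meaningful, and the derivatives below are taken within `[0,T]`. -/
def coord {E : Type} [Zero E] {T : ℝ} (u : Cylinder T → E) (t θ : ℝ) : E :=
  open scoped Classical in
  if h : t ∈ Icc (0 : ℝ) T then u (⟨t, h⟩, (θ : Real.Angle)) else 0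

/-- Smoothness (up to the boundary) of a map on the cylinder. -/
def IsSmooth {E : Type} [NormedAddCommGroup E] [NormedSpace ℝ E] {T : ℝ}
    (u : Cylinder T → E) : Prop :=
  ContDiffOn ℝ ∞ (fun p : ℝ × ℝ => coord u p.1 p.2) (Icc 0 T ×ˢ univ)

/-- `∂F/∂t`, one-sided at `t = 0` and `t = T`. -/
def partialT {E : Type} [NormedAddCommGroup E] [NormedSpace ℝ E] (T : ℝ) (F : ℝ → ℝ → E)
    (t θ : ℝ) : E :=
  derivWithin (fun t' => F t' θ) (Icc 0 T) t

/-- `∂F/∂θ`. -/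
def partialθ {E : Type} [NormedAddCommGroup E] [NormedSpace ℝ E] (F : ℝ → ℝ → E)
    (t θ : ℝ) : E :=
  deriv (fun θ' => F t θ') θ

/-! ### Rotationally symmetric metrics `g = f(t)² (dt² + dθ²)` and their Steklov eigenvalues -/

/-- `f` is smooth and positive on `[0,T]`, so that `f(t)² (dt² + dθ²)` is a Riemannian metric on
the cylinder `[0,T] × S¹`. -/
structure IsConformalFactor (T : ℝ) (f : ℝ → ℝ) : Prop where
  smooth : ContDiffOn ℝ ∞ f (Icc 0 T)
  pos : ∀ t ∈ Icc (0 : ℝ) T, 0 < f t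

/-- The Laplace–Beltrami operator of `f(t)² (dt² + dθ²)`:
`Δ u = f⁻² (∂²u/∂t² + ∂²u/∂θ²)`. -/
def laplacian {T : ℝ} (f : ℝ → ℝ) (u : Cylinder T → ℝ) (t θ : ℝ) : ℝ :=
  (f t ^ 2)⁻¹ * (partialT T (partialT T (coord u)) t θ + partialθ (partialθ (coord u)) t θ)

/-- The derivative of `u` along the outward unit normal `-f(0)⁻¹ ∂/∂t` at the boundary circle
`t = 0`. -/
def normalDerivLeft {T : ℝ} (f : ℝ → ℝ) (u : Cylinder T → ℝ) (θ : ℝ) : ℝ :=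
  -((f 0)⁻¹ * partialT T (coord u) 0 θ)

/-- The derivative of `u` along the outward unit normal `f(T)⁻¹ ∂/∂t` at the boundary circle
`t = T`. -/
def normalDerivRight {T : ℝ} (f : ℝ → ℝ) (u : Cylinder T → ℝ) (θ : ℝ) : ℝ :=
  (f T)⁻¹ * partialT T (coord u) T θ

/-- `u` is (zero or) a Steklov eigenfunction with eigenvalue `σ` of the metric
`f(t)² (dt² + dθ²)`: it is smooth and harmonic, and `∂u/∂n = σ u` on the boundary. Equivalently, `u`
is the harmonic extension of its boundary values `φ`, and the Dirichlet-to-Neumann map sends `φ`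
to `σ φ`. -/
structure IsEigenfunction {T : ℝ} (f : ℝ → ℝ) (σ : ℝ) (u : Cylinder T → ℝ) : Prop where
  smooth : IsSmooth u
  harmonic : ∀ t ∈ Icc (0 : ℝ) T, ∀ θ : ℝ, laplacian f u t θ = 0
  left : ∀ θ : ℝ, normalDerivLeft f u θ = σ * coord u 0 θ
  right : ∀ θ : ℝ, normalDerivRight f u θ = σ * coord u T θ

/-- The linear span of the Steklov eigenfunctions with eigenvalue in `S`. For `S = {σ}` it is the
eigenspace of `σ`. -/
def eigenSpan (T : ℝ) (f : ℝ → ℝ) (S : Set ℝ) : Submodule ℝ (Cylinder T → ℝ) :=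
  Submodule.span ℝ {u | ∃ σ ∈ S, IsEigenfunction f σ u}

/-- `σ` is the `k`-th Steklov eigenvalue, `k = 0, 1, 2, …`, in the nondecreasing list
`σ₀ ≤ σ₁ ≤ σ₂ ≤ …` of the Steklov eigenvalues repeated according to multiplicity: at most `k` of them
are smaller than `σ` and more than `k` of them are at most `σ`. -/
def IsKthEigenvalue (T : ℝ) (f : ℝ → ℝ) (k : ℕ) (σ : ℝ) : Prop :=
  Module.rank ℝ (eigenSpan T f (Iio σ)) ≤ (k : Cardinal) ∧
    (k : Cardinal) < Module.rank ℝ (eigenSpan T f (Iic σ))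

/-- The `k`-th Steklov eigenvalue `σ_k` of `f(t)² (dt² + dθ²)`, counted with multiplicity
and starting from `σ₀`: the least `σ` such that more than `k` eigenvalues are at most `σ`. -/
def eigenvalue (T : ℝ) (f : ℝ → ℝ) (k : ℕ) : ℝ :=
  sInf {σ : ℝ | (k : Cardinal) < Module.rank ℝ (eigenSpan T f (Iic σ))}

/-- The length of the boundary: two circles of length `2π f(0)` and `2π f(T)`. -/
def boundaryLength (T : ℝ) (f : ℝ → ℝ) : ℝ :=
  2 * π * f 0 + 2 * π * f T

/-- The normalized Steklov eigenvalue `σ_k L(∂Σ)`. -/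
def normalizedEigenvalue (T : ℝ) (f : ℝ → ℝ) (k : ℕ) : ℝ :=
  eigenvalue T f k * boundaryLength T f

/-! ### Immersed surfaces in `ℝ³` -/

/-- The immersion `X` is an isometric immersion of the metric `f(t)² (dt² + dθ²)`, that is, this
metric is the one that `X` induces on the cylinder. -/
def IsInducedMetric {T : ℝ} (f : ℝ → ℝ) (X : Cylinder T → EuclideanSpace ℝ (Fin 3)) : Prop :=
  ∀ t ∈ Icc (0 : ℝ) T, ∀ θ : ℝ,
    ⟪partialT T (coord X) t θ, partialT T (coord X) t θ⟫_ℝ = f t ^ 2 ∧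
    ⟪partialT T (coord X) t θ, partialθ (coord X) t θ⟫_ℝ = 0 ∧
    ⟪partialθ (coord X) t θ, partialθ (coord X) t θ⟫_ℝ = f t ^ 2

/-- The mean curvature `(e G - 2 f F + g E) / (2 (E G - F²))` of the surface `X` at `(t, θ)` with
respect to a unit normal vector `N`, where `E, F, G` and `e, f, g` are the coefficients of the first
and of the second fundamental form. -/
def meanCurvature {T : ℝ} (X : Cylinder T → EuclideanSpace ℝ (Fin 3)) (t θ : ℝ)
    (N : EuclideanSpace ℝ (Fin 3)) : ℝ :=
  let Xt := partialT T (coord X) t θ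
  let Xθ := partialθ (coord X) t θ
  let Xtt := partialT T (partialT T (coord X)) t θ
  let Xtθ := partialT T (partialθ (coord X)) t θ
  let Xθθ := partialθ (partialθ (coord X)) t θ
  (⟪Xtt, N⟫_ℝ * ⟪Xθ, Xθ⟫_ℝ - 2 * ⟪Xtθ, N⟫_ℝ * ⟪Xt, Xθ⟫_ℝ + ⟪Xθθ, N⟫_ℝ * ⟪Xt, Xt⟫_ℝ) /
    (2 * (⟪Xt, Xt⟫_ℝ * ⟪Xθ, Xθ⟫_ℝ - ⟪Xt, Xθ⟫_ℝ ^ 2))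

/-- `X` is a minimal immersion of the cylinder into the closed ball of radius `R` about the origin
of `ℝ³` with free boundary: the interior is mapped into the open ball, the boundary is mapped into the
sphere, and along the boundary the surface meets the sphere orthogonally (its tangent plane contains
the normal of the sphere, which is the position vector). -/
structure IsFreeBoundaryMinimal {T : ℝ} (R : ℝ) (X : Cylinder T → EuclideanSpace ℝ (Fin 3)) :
    Prop where
  smooth : IsSmooth X
  immersion : ∀ t ∈ Icc (0 : ℝ) T, ∀ θ : ℝ,
    LinearIndependent ℝ ![partialT T (coord X) t θ, partialθ (coord X) t θ]
  minimal : ∀ t ∈ Icc (0 : ℝ) T, ∀ θ : ℝ, ∀ N : EuclideanSpace ℝ (Fin 3), ‖N‖ = 1 →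
    ⟪partialT T (coord X) t θ, N⟫_ℝ = 0 → ⟪partialθ (coord X) t θ, N⟫_ℝ = 0 →
      meanCurvature X t θ N = 0
  interior : ∀ t ∈ Ioo (0 : ℝ) T, ∀ θ : ℝ, ‖coord X t θ‖ < R
  boundary : ∀ t ∈ ({0, T} : Set ℝ), ∀ θ : ℝ, ‖coord X t θ‖ = R
  orthogonal : ∀ t ∈ ({0, T} : Set ℝ), ∀ θ : ℝ,
    coord X t θ ∈ Submodule.span ℝ {partialT T (coord X) t θ, partialθ (coord X) t θ}

/-- The catenoid `(t, θ) ↦ (t, cosh t cos θ, cosh t sin θ)`. -/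
def catenoid (t : ℝ) (θ : Real.Angle) : EuclideanSpace ℝ (Fin 3) :=
  !₂[t, Real.cosh t * θ.cos, Real.cosh t * θ.sin]

/-- The `n`-catenoid `(t, θ) ↦ (n t, cosh (n t) cos (n θ), cosh (n t) sin (n θ))`. -/
def nCatenoid (n : ℕ) (t : ℝ) (θ : Real.Angle) : EuclideanSpace ℝ (Fin 3) :=
  catenoid (n * t) (n • θ)

/-- The portion `t ∈ [-s/n, s/n]` of the `n`-catenoid, parametrized over the cylinder
`[0, 2s/n] × S¹` by a translation of `t`. When `s = coth s` it is the critical `n`-catenoid. -/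
def nCatenoidPiece (n : ℕ) (s : ℝ) (p : Cylinder (2 * s / n)) : EuclideanSpace ℝ (Fin 3) :=
  nCatenoid n ((p.1 : ℝ) - s / n) p.2

end Steklov

end

noncomputable section

namespace Steklov

open MeasureTheory Filter Topology

/-! ### Hyperbolic functions -/

/-! Everything reduces to separation of variables and a count of roots of quadratics. Write a =
f(0), b = f(T). The Laplacian is conformal in dimension two, so the spectrum depends only on T, a
and b. A mode-k solution is a radial solution of y'' = k²y times cos kθ or sin kθ. With σ = 2ν/(a +
b), the two boundary conditions amount to r κ ν² - 2ν + k² κ = 0, where κ = tanh(kT)/k and r =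
4ab/(a + b)² ≤ 1 (`boundary_condition_iff`). Thus each integer k contributes a low and a high root,
and the normalized eigenvalue is 4πν. Fourier analysis on each circle shows that these product
solutions are independent and exhaust the spectrum (`linearIndependent_steklovFun`,
`mem_span_steklovFun`), so σ_k is found by counting indices (`eigenvalue_spec`).

The claim becomes: the root numbered 2n - 1 is at most n/s, with equality exactly for T = 2s/n and r
= 1. Low roots increase with |k| and with r; for r = 1 they are |k| tanh(|k|T/2), and the high roots
are k coth(kT/2), or 2/T for k = 0. Since 2n + 1 low roots have |k| ≤ n, the wanted root is at most
n tanh(nT/2). If T ≤ 2s/n this is at most n tanh s = n/s, and equality forces T = 2s/n and r = 1.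

If T = 2sm/n with m > 1, suppose that the low root of mode n still reaches n/s. Then r is close to 1
(`one_sub_le_of_le_lowRoot`), which pushes enough high roots below n/s: there are j + l + 1 = n such
that all low roots with |k| ≤ l and all high roots with |k| ≤ j lie below n/s (`exists_split`).
These are (2l + 1) + (2j + 1) = 2n roots, one too many below the root numbered 2n - 1. The explicit
estimates use s ≤ 6/5.

At T = 2s/n, r = 1, exactly the 2n - 1 low roots with |k| < n lie below n/s, and equality holds for
the high root of mode 0 and the low roots of modes ±n. Because s tanh s = 1, their eigenfunctions
are multiples of the coordinates of the critical n-catenoid. The geometric claims follow since that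
parametrization is conformal and harmonic. -/

theorem tanh_strictMono : StrictMono Real.tanh := by
  intro x y hxy
  rw [Real.tanh_eq_sinh_div_cosh, Real.tanh_eq_sinh_div_cosh,
    div_lt_div_iff₀ (Real.cosh_pos x) (Real.cosh_pos y)]
  have h : 0 < Real.sinh (y - x) := Real.sinh_pos_iff.2 (by linarith)
  rw [Real.sinh_sub] at h
  linarith

theorem tanh_nonneg {x : ℝ} (hx : 0 ≤ x) : 0 ≤ Real.tanh x := by
  simpa using tanh_strictMono.monotone hx

theorem tanh_pos {x : ℝ} (hx : 0 < x) : 0 < Real.tanh x := by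
  simpa using tanh_strictMono hx

theorem abs_tanh (x : ℝ) : |Real.tanh x| = Real.tanh |x| := by
  rcases le_total 0 x with h | h
  · rw [abs_of_nonneg h, abs_of_nonneg (tanh_nonneg h)]
  · rw [abs_of_nonpos h, Real.tanh_neg, abs_of_nonpos]
    have := tanh_nonneg (x := -x) (by linarith)
    rw [Real.tanh_neg] at this
    linarith

theorem tanh_two_mul (x : ℝ) : Real.tanh (2 * x) = 2 * Real.tanh x / (1 + Real.tanh x ^ 2) := by
  rw [Real.tanh_eq_sinh_div_cosh, Real.tanh_eq_sinh_div_cosh, Real.sinh_two_mul, Real.cosh_two_mul]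
  have := Real.cosh_pos x
  field_simp

theorem tanh_add (x y : ℝ) :
    Real.tanh (x + y) = (Real.tanh x + Real.tanh y) / (1 + Real.tanh x * Real.tanh y) := by
  simp only [Real.tanh_eq_sinh_div_cosh, Real.sinh_add, Real.cosh_add]
  have := Real.cosh_pos x
  have := Real.cosh_pos y
  have h3 := Real.cosh_pos (x + y)
  rw [Real.cosh_add] at h3
  have h4 : 1 + Real.sinh x / Real.cosh x * (Real.sinh y / Real.cosh y)
      = (Real.cosh x * Real.cosh y + Real.sinh x * Real.sinh y) / (Real.cosh x * Real.cosh y) := by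
    field_simp
  have h5 : Real.sinh x / Real.cosh x + Real.sinh y / Real.cosh y
      = (Real.sinh x * Real.cosh y + Real.cosh x * Real.sinh y) / (Real.cosh x * Real.cosh y) := by
    field_simp
  rw [h4, h5, div_div_div_cancel_right₀ (by positivity)]

theorem tanh_le_self {x : ℝ} (hx : 0 ≤ x) : Real.tanh x ≤ x := by
  have hd : ∀ y, HasDerivAt (fun y => y * Real.cosh y - Real.sinh y)
      (1 * Real.cosh y + y * Real.sinh y - Real.cosh y) y := fun y =>
    ((hasDerivAt_id y).mul (Real.hasDerivAt_cosh y)).sub (Real.hasDerivAt_sinh y)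
  have hm : MonotoneOn (fun y => y * Real.cosh y - Real.sinh y) (Ici 0) := by
    refine monotoneOn_of_deriv_nonneg (convex_Ici 0)
      (fun y _ => (hd y).continuousAt.continuousWithinAt)
      (fun y _ => (hd y).differentiableAt.differentiableWithinAt) fun y hy => ?_
    rw [interior_Ici] at hy
    rw [(hd y).deriv]
    have := mul_nonneg hy.le (Real.sinh_nonneg_iff.2 hy.le)
    linarith
  have := hm (mem_Ici.2 le_rfl) hx hx
  simp only [Real.sinh_zero, zero_mul, sub_zero, sub_nonneg] at this
  rw [Real.tanh_eq_sinh_div_cosh, div_le_iff₀ (Real.cosh_pos x)]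
  exact this

/-- The unique positive solution of `s = coth s`. -/
theorem exists_coth_fixed : ∃ s : ℝ, (0 < s ∧ s = Real.cosh s / Real.sinh s ∧
    ∀ s' : ℝ, 0 < s' → s' = Real.cosh s' / Real.sinh s' → s' = s) ∧
    1 < s ∧ s ≤ 6 / 5 ∧ Real.tanh s = 1 / s := by
  have key : ∀ x : ℝ, 0 < x → (x = Real.cosh x / Real.sinh x ↔ x * Real.tanh x = 1) := by
    intro x hx
    have h1 := Real.sinh_pos_iff.2 hx
    have h2 := Real.cosh_pos x
    rw [Real.tanh_eq_sinh_div_cosh, eq_div_iff h1.ne', ← mul_div_assoc, div_eq_one_iff_eq h2.ne']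
  have hc : ContinuousOn (fun x : ℝ => x * Real.sinh x - Real.cosh x) (Icc 0 (6 / 5)) := by
    fun_prop
  -- After clearing exponentials this says e^(12/5) ≥ 11, proved by comparing fifth powers. The root
  -- is about 1.1997, so 6/5 is nearly sharp.
  have h65 : 0 ≤ (6 / 5 : ℝ) * Real.sinh (6 / 5) - Real.cosh (6 / 5) := by
    have h12 : (11 : ℝ) ^ 5 ≤ Real.exp 12 := by
      have h := Real.exp_one_gt_d9
      have h' : Real.exp 12 = Real.exp 1 ^ 12 := by rw [← Real.exp_nat_mul]; norm_num
      rw [h']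
      calc (11 : ℝ) ^ 5 ≤ 2.7182818283 ^ 12 := by norm_num
        _ ≤ _ := by gcongr
    have h24 : (11 : ℝ) ≤ Real.exp (12 / 5) := by
      have h' : Real.exp 12 = Real.exp (12 / 5) ^ 5 := by rw [← Real.exp_nat_mul]; norm_num
      rw [h'] at h12
      exact le_of_pow_le_pow_left₀ (by norm_num) (Real.exp_pos _).le h12
    have h3 : Real.exp (12 / 5) = Real.exp (6 / 5) * Real.exp (6 / 5) := by
      rw [← Real.exp_add]; norm_num
    have h4 : Real.exp (6 / 5) * Real.exp (-(6 / 5)) = 1 := by rw [← Real.exp_add]; simp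
    have h5 := Real.exp_pos (-(6 / 5))
    have h6 : 11 * Real.exp (-(6 / 5)) ≤ Real.exp (6 / 5) := by
      calc 11 * Real.exp (-(6 / 5)) ≤ Real.exp (12 / 5) * Real.exp (-(6 / 5)) := by gcongr
        _ = Real.exp (6 / 5) := by rw [h3, mul_assoc, h4, mul_one]
    rw [Real.sinh_eq, Real.cosh_eq]
    linarith
  obtain ⟨s, hs, hs0⟩ := intermediate_value_Icc (by norm_num : (0 : ℝ) ≤ 6 / 5) hc
    (show (0 : ℝ) ∈ _ from ⟨by simp, h65⟩)
  simp only at hs0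
  have hpos : 0 < s := by
    rcases hs.1.eq_or_lt with h | h
    · rw [← h] at hs0; simp at hs0
    · exact h
  have hs1 : s = Real.cosh s / Real.sinh s := by
    rw [eq_div_iff (Real.sinh_pos_iff.2 hpos).ne']; linarith
  have ht := (key s hpos).1 hs1
  refine ⟨s, ⟨hpos, hs1, fun s' h0 h' => ?_⟩, ?_, hs.2, ?_⟩
  · have ht' := (key s' h0).1 h'
    have hp := tanh_pos hpos
    have hp' := tanh_pos h0
    -- Uniqueness holds because x tanh x is strictly increasing for x > 0.
    rcases lt_trichotomy s' s with h | h | h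
    · have := tanh_strictMono h
      nlinarith
    · exact h
    · have := tanh_strictMono h
      nlinarith
  · have := Real.tanh_lt_one s
    nlinarith
  · field_simp
    linarith

/-! ### Radial solutions of mode `k` -/

/-- The solution of `y'' = k² y` with `y 0 = 1`, `y' 0 = 0`. -/
def modeCosh (k t : ℝ) : ℝ := Real.cosh (k * t)

/-- The solution of `y'' = k² y` with `y 0 = 0`, `y' 0 = 1`. -/
def modeSinh (k t : ℝ) : ℝ := if k = 0 then t else Real.sinh (k * t) / k

theorem mul_modeSinh (k t : ℝ) : k * modeSinh k t = Real.sinh (k * t) := by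
  unfold modeSinh
  split_ifs with h
  · simp [h]
  · field_simp

theorem modeCosh_zero_right (k : ℝ) : modeCosh k 0 = 1 := by simp [modeCosh]

theorem modeSinh_zero_right (k : ℝ) : modeSinh k 0 = 0 := by simp [modeSinh]

theorem modeCosh_pos (k t : ℝ) : 0 < modeCosh k t := Real.cosh_pos _

theorem modeSinh_pos (k : ℝ) {t : ℝ} (ht : 0 < t) : 0 < modeSinh k t := by
  unfold modeSinh
  split_ifs with h
  · exact ht
  · rcases lt_or_gt_of_ne h with h | h
    · exact div_pos_of_neg_of_neg (Real.sinh_neg_iff.2 (mul_neg_of_neg_of_pos h ht)) h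
    · exact div_pos (Real.sinh_pos_iff.2 (mul_pos h ht)) h

theorem modeCosh_sq (k t : ℝ) : modeCosh k t ^ 2 - k ^ 2 * modeSinh k t ^ 2 = 1 := by
  rw [← mul_pow, mul_modeSinh]
  exact Real.cosh_sq_sub_sinh_sq _

theorem hasDerivAt_modeCosh (k t : ℝ) :
    HasDerivAt (modeCosh k) (k ^ 2 * modeSinh k t) t := by
  have := (Real.hasDerivAt_cosh (k * t)).comp t ((hasDerivAt_id t).const_mul k)
  convert! this using 1
  rw [← mul_modeSinh]; simp; ring

theorem hasDerivAt_modeSinh (k t : ℝ) : HasDerivAt (modeSinh k) (modeCosh k t) t := by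
  by_cases h : k = 0
  · have : modeSinh k = id := by ext x; simp [modeSinh, h]
    rw [this]
    simpa [modeCosh, h] using hasDerivAt_id t
  · have h1 : modeSinh k = fun x => Real.sinh (k * x) / k := by ext x; simp [modeSinh, h]
    rw [h1]
    have := ((Real.hasDerivAt_sinh (k * t)).comp t ((hasDerivAt_id t).const_mul k)).div_const k
    convert! this using 1
    simp [modeCosh, h]

theorem contDiff_modeCosh (k : ℝ) : ContDiff ℝ ∞ (modeCosh k) := by
  unfold modeCosh; fun_prop

theorem contDiff_modeSinh (k : ℝ) : ContDiff ℝ ∞ (modeSinh k) := by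
  by_cases h : k = 0
  · have : modeSinh k = id := by ext x; simp [modeSinh, h]
    rw [this]; exact contDiff_id
  · have h1 : modeSinh k = fun x => Real.sinh (k * x) / k := by ext x; simp [modeSinh, h]
    rw [h1]; fun_prop

/-- `tanh (k T) / k`, which is `T` for `k = 0`. -/
def ratio (T k : ℝ) : ℝ := modeSinh k T / modeCosh k T

theorem ratio_pos {T : ℝ} (hT : 0 < T) (k : ℝ) : 0 < ratio T k :=
  div_pos (modeSinh_pos k hT) (modeCosh_pos k T)

theorem mul_ratio (T k : ℝ) : k * ratio T k = Real.tanh (k * T) := by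
  rw [ratio, ← mul_div_assoc, mul_modeSinh, Real.tanh_eq_sinh_div_cosh, modeCosh]

theorem ratio_zero (T : ℝ) : ratio T 0 = T := by simp [ratio, modeSinh, modeCosh]

theorem abs_mul_ratio {T : ℝ} (hT : 0 < T) (k : ℝ) : |k| * ratio T k = Real.tanh (|k| * T) := by
  rw [← abs_of_pos (ratio_pos hT k), ← abs_mul, mul_ratio, abs_tanh, abs_mul, abs_of_pos hT]

/-- This is tanh x ≥ x / √(1 + x²), a consequence of sinh x ≥ x. It is the algebraic lower bound on
κ from which high roots are bounded above. -/
theorem sq_le_ratio (T k : ℝ) :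
    T ^ 2 ≤ ratio T k ^ 2 * (1 + (k * T) ^ 2) := by
  by_cases h : k = 0
  · simp [h, ratio_zero]
  · have h1 : (k * T) ^ 2 ≤ Real.sinh (k * T) ^ 2 := by
      rw [sq_le_sq, Real.abs_sinh]
      exact Real.self_le_sinh_iff.2 (abs_nonneg _)
    have h2 := Real.cosh_sq (k * T)
    have h3 := Real.cosh_pos (k * T)
    have h4 : (k * T) ^ 2 ≤ (k * ratio T k) ^ 2 * (1 + (k * T) ^ 2) := by
      rw [mul_ratio, Real.tanh_eq_sinh_div_cosh, div_pow, div_mul_eq_mul_div,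
        le_div_iff₀ (by positivity), h2]
      nlinarith
    rw [mul_pow, mul_pow, mul_assoc] at h4
    rw [mul_pow]
    exact le_of_mul_le_mul_left h4 (by positivity)

/-! ### The two normalized eigenvalues of mode `k` -/

/-- The radical in the two roots of `r κ ν² - 2 ν + k² κ`, where `κ = ratio T k`. -/
def radical (r T k : ℝ) : ℝ := √(1 - r * (k * ratio T k) ^ 2)

/-- The smaller root of `r κ ν² - 2 ν + k² κ`, where `κ = ratio T k`. -/
def lowRoot (r T k : ℝ) : ℝ := k ^ 2 * ratio T k / (1 + radical r T k)

/-- The larger root of `r κ ν² - 2 ν + k² κ`, where `κ = ratio T k`. -/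
def highRoot (r T k : ℝ) : ℝ := (1 + radical r T k) / (r * ratio T k)

section roots
variable {r T : ℝ}

theorem radicand_pos (hr1 : r ≤ 1) (k : ℝ) : 0 < 1 - r * (k * ratio T k) ^ 2 := by
  have := Real.tanh_sq_lt_one (k * T)
  rw [mul_ratio]
  nlinarith [sq_nonneg (Real.tanh (k * T))]

theorem radical_pos (hr1 : r ≤ 1) (k : ℝ) : 0 < radical r T k := Real.sqrt_pos.2 (radicand_pos hr1 k)

theorem radical_sq (hr1 : r ≤ 1) (k : ℝ) : radical r T k ^ 2 = 1 - r * (k * ratio T k) ^ 2 :=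
  Real.sq_sqrt (radicand_pos hr1 k).le

/-- Multiplying by the leading coefficient r κ completes the square. `lowRoot` is the rationalized
form of (1 - radical)/(r κ), which makes its dependence on k and r monotone at sight. -/
theorem root_iff (hr : 0 < r) (hr1 : r ≤ 1) (hT : 0 < T) (k ν : ℝ) : r * ratio T k * ν ^ 2 - 2 * ν + k ^ 2 * ratio T k = 0 ↔
    ν = lowRoot r T k ∨ ν = highRoot r T k := by
  have hκ := ratio_pos hT k
  have hq := radical_pos (T := T) hr1 k
  have hs := radical_sq (T := T) hr1 k
  have hlow : lowRoot r T k = (1 - radical r T k) / (r * ratio T k) := by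
    unfold lowRoot
    rw [div_eq_div_iff (by positivity) (by positivity)]
    linarith
  have hfac : r * ratio T k * (r * ratio T k * ν ^ 2 - 2 * ν + k ^ 2 * ratio T k) =
      (r * ratio T k * ν - (1 - radical r T k)) * (r * ratio T k * ν - (1 + radical r T k)) := by
    linarith
  rw [hlow, highRoot, eq_div_iff (by positivity), eq_div_iff (by positivity)]
  constructor
  · intro h
    rw [h, mul_zero] at hfac
    rcases mul_eq_zero.1 hfac.symm with h | h
    · left; linarith
    · right; linarith
  · intro h
    have : r * ratio T k * (r * ratio T k * ν ^ 2 - 2 * ν + k ^ 2 * ratio T k) = 0 := by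
      rw [hfac]
      rcases h with h | h
      · rw [mul_comm ν] at h; rw [h]; ring
      · rw [mul_comm ν] at h; rw [h]; ring
    exact (mul_eq_zero.1 this).resolve_left (by positivity)

theorem lowRoot_lt_highRoot (hr : 0 < r) (hr1 : r ≤ 1) (hT : 0 < T) (k : ℝ) : lowRoot r T k < highRoot r T k := by
  have hκ := ratio_pos hT k
  have hq := radical_pos (T := T) hr1 k
  have hs := radical_sq (T := T) hr1 k
  unfold lowRoot highRoot
  rw [div_lt_div_iff₀ (by positivity) (by positivity)]
  nlinarith

theorem lowRoot_eq (hT : 0 < T) (k : ℝ) :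
    lowRoot r T k = |k| * Real.tanh (|k| * T) / (1 + √(1 - r * Real.tanh (|k| * T) ^ 2)) := by
  rw [lowRoot, radical, ← abs_mul_ratio hT, ← sq_abs k, mul_pow, mul_pow, sq_abs]
  congr 1
  rw [← mul_assoc, ← sq, sq_abs]

/-- In the rationalized form the numerator grows with tanh(|k|T) while the radical shrinks. -/
theorem lowRoot_mono (hr : 0 < r) (hT : 0 < T) {k l : ℝ} (h : |k| ≤ |l|) : lowRoot r T k ≤ lowRoot r T l := by
  rw [lowRoot_eq hT, lowRoot_eq hT]
  have h1 : Real.tanh (|k| * T) ≤ Real.tanh (|l| * T) := tanh_strictMono.monotone (by gcongr)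
  have h0 : 0 ≤ Real.tanh (|k| * T) := tanh_nonneg (by positivity)
  have h2 : 0 ≤ Real.tanh (|l| * T) := h0.trans h1
  gcongr

/-- The root is 1 / cosh 2x, so this is the half-argument formula sinh 2x / (1 + cosh 2x) = tanh x.
It puts the balanced low root in closed form. -/
theorem sqrt_one_sub_tanh_sq (x : ℝ) :
    Real.tanh (2 * x) / (1 + √(1 - 1 * Real.tanh (2 * x) ^ 2)) = Real.tanh x := by
  have h1 := Real.tanh_sq_lt_one x
  have h2 : 1 - 1 * Real.tanh (2 * x) ^ 2 =
      ((1 - Real.tanh x ^ 2) / (1 + Real.tanh x ^ 2)) ^ 2 := by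
    rw [tanh_two_mul]; field_simp; ring
  rw [h2, Real.sqrt_sq (div_nonneg (by linarith) (by positivity)), tanh_two_mul]
  field_simp
  ring

theorem lowRoot_one (hT : 0 < T) (k : ℝ) : lowRoot 1 T k = |k| * Real.tanh (|k| * T / 2) := by
  rw [lowRoot_eq hT, mul_div_assoc]
  have := sqrt_one_sub_tanh_sq (|k| * T / 2)
  rw [mul_div_cancel₀ _ two_ne_zero] at this
  rw [this]

theorem lowRoot_le (hr1 : r ≤ 1) (hT : 0 < T) (k : ℝ) : lowRoot r T k ≤ |k| * Real.tanh (|k| * T / 2) := by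
  rw [← lowRoot_one hT, lowRoot_eq hT, lowRoot_eq hT]
  have h0 : 0 ≤ Real.tanh (|k| * T) := tanh_nonneg (by positivity)
  gcongr

theorem lowRoot_lt (hT : 0 < T) {k : ℝ} (hk : k ≠ 0) (h : r < 1) :
    lowRoot r T k < |k| * Real.tanh (|k| * T / 2) := by
  rw [← lowRoot_one hT, lowRoot_eq hT, lowRoot_eq hT]
  have hk' := abs_pos.2 hk
  have h0 : 0 < Real.tanh (|k| * T) := tanh_pos (by positivity)
  have h1 := Real.tanh_sq_lt_one (|k| * T)
  have h2 : √(1 - 1 * Real.tanh (|k| * T) ^ 2) < √(1 - r * Real.tanh (|k| * T) ^ 2) :=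
    Real.sqrt_lt_sqrt (by linarith) (by
      have := pow_pos h0 2
      gcongr)
  gcongr

/-- Linear growth in |k| leaves only finitely many roots below any bound. -/
theorem le_lowRoot (hr : 0 < r) (hT : 0 < T) {k : ℝ} (hk : 1 ≤ |k|) : |k| * Real.tanh T / 2 ≤ lowRoot r T k := by
  rw [lowRoot_eq hT]
  have h0 : 0 ≤ Real.tanh T := tanh_nonneg hT.le
  have h1 : Real.tanh T ≤ Real.tanh (|k| * T) := tanh_strictMono.monotone (by nlinarith)
  have h2 : √(1 - r * Real.tanh (|k| * T) ^ 2) ≤ 1 := by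
    refine Real.sqrt_le_one.2 ?_
    have := mul_nonneg hr.le (sq_nonneg (Real.tanh (|k| * T)))
    linarith
  have h3 : 1 + √(1 - r * Real.tanh (|k| * T) ^ 2) ≤ 2 := by linarith
  have h4 : 0 ≤ |k| * Real.tanh (|k| * T) := mul_nonneg (abs_nonneg k) (h0.trans h1)
  gcongr

/-- The first condition puts M to the right of the vertex 1/(r κ) of the parabola, the second makes
the quadratic positive there, so M is beyond the larger root. -/
theorem highRoot_lt (hr : 0 < r) (hr1 : r ≤ 1) (hT : 0 < T) {k M : ℝ} (h1 : 1 < M * (r * ratio T k))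
    (h2 : 0 < r * ratio T k * M ^ 2 - 2 * M + k ^ 2 * ratio T k) : highRoot r T k < M := by
  have hκ := ratio_pos hT k
  have hs := radical_sq (T := T) hr1 k
  unfold highRoot
  rw [div_lt_iff₀ (by positivity)]
  have h3 : radical r T k ^ 2 < (M * (r * ratio T k) - 1) ^ 2 := by
    have := mul_pos (mul_pos hr hκ) h2
    rw [hs]; nlinarith
  have := lt_of_pow_lt_pow_left₀ 2 (by linarith) h3
  linarith

theorem highRoot_one_zero : highRoot 1 T 0 = 2 / T := by
  simp [highRoot, radical, ratio_zero]; norm_num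

theorem lt_highRoot_one (hT : 0 < T) {k : ℝ} (hk : k ≠ 0) : 2 / T < highRoot 1 T k := by
  -- the larger root is `k coth (k T / 2)`
  have hκ := ratio_pos hT k
  have hq := radical_pos (T := T) le_rfl k
  have hk' := abs_pos.2 hk
  have hx : 0 < |k| * T / 2 := by positivity
  have ht := tanh_pos hx
  -- For r = 1 the product of the two roots is k², so the high root is found from the low one.
  have hprod : lowRoot 1 T k * highRoot 1 T k = k ^ 2 := by
    unfold lowRoot highRoot; field_simp
  rw [lowRoot_one hT, ← sq_abs k] at hprod
  have h2 : Real.tanh (|k| * T / 2) * highRoot 1 T k = |k| := by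
    have : |k| * (Real.tanh (|k| * T / 2) * highRoot 1 T k) = |k| * |k| := by linarith
    exact mul_left_cancel₀ hk'.ne' this
  have h3 := Real.tanh_lt_one (|k| * T / 2)
  -- Strictness comes from the denominator 1 + tanh² > 1 in the doubling formula.
  have h5 : Real.tanh (|k| * T / 2) < |k| * T / 2 := by
    have hh : 0 < |k| * T / 4 := by positivity
    have e : |k| * T / 2 = 2 * (|k| * T / 4) := by ring
    have h4 := tanh_le_self hh.le
    have hp := tanh_pos hh
    rw [e, tanh_two_mul, div_lt_iff₀ (by positivity)]
    have := mul_pos hh (pow_pos hp 2)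
    linarith
  have hH : 0 < highRoot 1 T k := by unfold highRoot; positivity
  rw [div_lt_iff₀ hT]
  have : |k| < |k| * T / 2 * highRoot 1 T k := by
    calc |k| = Real.tanh (|k| * T / 2) * highRoot 1 T k := h2.symm
      _ < _ := by gcongr
  have : |k| * 2 < |k| * (highRoot 1 T k * T) := by linarith
  exact lt_of_mul_lt_mul_left this hk'.le

end roots

/-! ### Trigonometric waves -/

/-- `cos (k θ)` for `k ≥ 0` and `sin (k θ)` for `k < 0`. -/
def wave (k : ℤ) (θ : Real.Angle) : ℝ := if 0 ≤ k then (k • θ).cos else (k • θ).sin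

theorem wave_coe (k : ℤ) (θ : ℝ) :
    wave k θ = if 0 ≤ k then Real.cos (k * θ) else Real.sin (k * θ) := by
  have : k • (θ : Real.Angle) = ((k * θ : ℝ) : Real.Angle) := by
    rw [← zsmul_eq_mul, Real.Angle.coe_zsmul]
  rw [wave, this, Real.Angle.cos_coe, Real.Angle.sin_coe]

theorem wave_of_nonneg {k : ℤ} (hk : 0 ≤ k) (θ : ℝ) : wave k θ = Real.cos (k * θ) := by
  rw [wave_coe, if_pos hk]

theorem wave_of_neg {k : ℤ} (hk : k < 0) (θ : ℝ) : wave k θ = Real.sin (k * θ) := by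
  rw [wave_coe, if_neg (not_le.2 hk)]

theorem contDiff_wave (k : ℤ) : ContDiff ℝ ∞ (fun θ : ℝ => wave k θ) := by
  rcases le_or_gt 0 k with h | h
  · simp only [wave_of_nonneg h]; fun_prop
  · simp only [wave_of_neg h]; fun_prop

/-- Negating the index swaps sine and cosine, and the sign convention for `wave` makes one formula
serve all k. -/
theorem hasDerivAt_wave (k : ℤ) (θ : ℝ) :
    HasDerivAt (fun θ : ℝ => wave k θ) (k * wave (-k) θ) θ := by
  have hl : HasDerivAt (fun θ : ℝ => (k : ℝ) * θ) k θ := by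
    simpa using (hasDerivAt_id θ).const_mul (k : ℝ)
  rcases lt_trichotomy 0 k with h | h | h
  · simp only [wave_of_nonneg h.le, wave_of_neg (neg_lt_zero.2 h)]
    convert! hl.cos using 1
    push_cast
    rw [neg_mul, Real.sin_neg]; ring
  · subst h
    simp only [wave_of_nonneg le_rfl, Int.cast_zero, zero_mul]
    exact hasDerivAt_const _ _
  · simp only [wave_of_neg h, wave_of_nonneg (by lia : 0 ≤ -k)]
    convert! hl.sin using 1
    push_cast
    rw [neg_mul, Real.cos_neg]; ring

theorem continuous_wave (k : ℤ) : Continuous (fun θ : ℝ => wave k θ) := (contDiff_wave k).continuous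

theorem wave_two_pi (k : ℤ) : wave k ((2 * π : ℝ) : Real.Angle) = wave k ((0 : ℝ) : Real.Angle) := by
  rw [Real.Angle.coe_two_pi, Real.Angle.coe_zero]

theorem integral_wave_mul_wave_of_ne {k l : ℤ} (h : k ≠ l) :
    ∫ θ in (0 : ℝ)..2 * π, wave k θ * wave l θ = 0 := by
  have key : ∀ (c : ℝ) (H : ℝ → ℝ), c ≠ 0 → H (2 * π) = H 0 →
      (∀ θ : ℝ, HasDerivAt H (c * (wave k θ * wave l θ)) θ) →
      ∫ θ in (0 : ℝ)..2 * π, wave k θ * wave l θ = 0 := by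
    intro c H hc hH hd
    have hcont : Continuous fun θ : ℝ => c * (wave k θ * wave l θ) :=
      continuous_const.mul ((continuous_wave k).mul (continuous_wave l))
    have := intervalIntegral.integral_eq_sub_of_hasDerivAt (a := 0) (b := 2 * π)
      (fun θ _ => hd θ) (hcont.intervalIntegrable _ _)
    rw [hH, sub_self, intervalIntegral.integral_const_mul] at this
    exact (mul_eq_zero.1 this).resolve_left hc
  by_cases h2 : (k : ℝ) ^ 2 = (l : ℝ) ^ 2
  · have hl : l = -k := by
      rcases sq_eq_sq_iff_eq_or_eq_neg.1 h2 with h3 | h3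
      · exact absurd (by exact_mod_cast h3) h
      · have : k = -l := by exact_mod_cast h3
        lia
    have hk : (k : ℝ) ≠ 0 := by
      intro h0
      have : k = 0 := by exact_mod_cast h0
      lia
    subst hl
    -- For l = -k the product is, up to the factor 2k, the derivative of `wave k` squared.
    refine key (2 * k) (fun θ => wave k θ ^ 2) (by simpa using hk) (by simp only [wave_two_pi]) ?_
    intro θ
    convert! (hasDerivAt_wave k θ).pow 2 using 1
    simp; ring
  -- For k² ≠ l² the antiderivative is the Wronskian of the two waves.
  · refine key ((l : ℝ) ^ 2 - (k : ℝ) ^ 2)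
      (fun θ => k * wave (-k) θ * wave l θ - wave k θ * (l * wave (-l) θ))
      (by rw [sub_ne_zero]; exact fun h => h2 h.symm) (by simp only [wave_two_pi]) ?_
    intro θ
    have h1 := hasDerivAt_wave (-k) θ
    have h3 := hasDerivAt_wave (-l) θ
    rw [neg_neg] at h1 h3
    convert! ((h1.const_mul (k : ℝ)).mul (hasDerivAt_wave l θ)).sub
      ((hasDerivAt_wave k θ).mul (h3.const_mul (l : ℝ))) using 1
    push_cast
    ring

theorem integral_wave_mul_self_pos (k : ℤ) :
    0 < ∫ θ in (0 : ℝ)..2 * π, wave k θ * wave k θ := by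
  have hπ := Real.pi_pos
  refine intervalIntegral.integral_pos (by positivity)
    ((continuous_wave k).mul (continuous_wave k)).continuousOn
    (fun θ _ => mul_self_nonneg _) ?_
  rcases le_or_gt 0 k with h | h
  · exact ⟨0, ⟨le_rfl, by positivity⟩, by simp [wave_of_nonneg h, -Real.Angle.coe_zero]⟩
  · have hk : (1 : ℝ) ≤ -k := by exact_mod_cast (by lia : 1 ≤ -k)
    refine ⟨π / (2 * -k), ⟨by positivity, ?_⟩, ?_⟩
    · rw [div_le_iff₀ (by positivity)]
      nlinarith
    · have : (k : ℝ) * (π / (2 * -k)) = -(π / 2) := by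
        have : (k : ℝ) ≠ 0 := by linarith
        field_simp
      rw [wave_of_neg h, this, Real.sin_neg, Real.sin_pi_div_two]
      norm_num

/-! ### Calculus on the cylinder -/

theorem uniqueDiffOn_strip {T : ℝ} (hT : 0 < T) :
    UniqueDiffOn ℝ (Icc (0 : ℝ) T ×ˢ (univ : Set ℝ)) :=
  (uniqueDiffOn_Icc hT).prod uniqueDiffOn_univ

section calculus

variable {E : Type} [NormedAddCommGroup E] [NormedSpace ℝ E] {T : ℝ}

theorem partialT_eq (hT : 0 < T) {F : ℝ → ℝ → E} {G : ℝ → E} {G' : E} {t θ : ℝ}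
    (ht : t ∈ Icc 0 T) (hF : ∀ t ∈ Icc 0 T, F t θ = G t) (hG : HasDerivAt G G' t) :
    partialT T F t θ = G' := by
  rw [partialT, derivWithin_congr hF (hF t ht)]
  exact hG.hasDerivWithinAt.derivWithin (uniqueDiffOn_Icc hT t ht)

theorem partialθ_eq {F : ℝ → ℝ → E} {G : ℝ → E} {G' : E} {t θ : ℝ}
    (hF : ∀ θ, F t θ = G θ) (hG : HasDerivAt G G' θ) : partialθ F t θ = G' := by
  rw [partialθ, funext hF]
  exact hG.deriv

variable {F : ℝ → ℝ → E}

theorem hasDerivWithinAt_partialT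
    (hF : ContDiffOn ℝ ∞ (fun p : ℝ × ℝ => F p.1 p.2) (Icc 0 T ×ˢ univ))
    {t : ℝ} (ht : t ∈ Icc 0 T) (θ : ℝ) :
    HasDerivWithinAt (fun t' => F t' θ)
      (fderivWithin ℝ (fun p : ℝ × ℝ => F p.1 p.2) (Icc 0 T ×ˢ univ) (t, θ) (1, 0)) (Icc 0 T) t := by
  have h := (hF.differentiableOn (by simp) (t, θ) ⟨ht, mem_univ θ⟩).hasFDerivWithinAt
  have hγ : HasDerivWithinAt (fun t' : ℝ => (t', θ)) ((1 : ℝ), (0 : ℝ)) (Icc 0 T) t :=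
    ((hasDerivAt_id t).prodMk (hasDerivAt_const t θ)).hasDerivWithinAt
  exact h.comp_hasDerivWithinAt (f := fun t' : ℝ => (t', θ)) t hγ (fun x hx => ⟨hx, mem_univ _⟩)

theorem hasDerivAt_partialθ
    (hF : ContDiffOn ℝ ∞ (fun p : ℝ × ℝ => F p.1 p.2) (Icc 0 T ×ˢ univ))
    {t : ℝ} (ht : t ∈ Icc 0 T) (θ : ℝ) :
    HasDerivAt (fun θ' => F t θ')
      (fderivWithin ℝ (fun p : ℝ × ℝ => F p.1 p.2) (Icc 0 T ×ˢ univ) (t, θ) (0, 1)) θ := by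
  have h := (hF.differentiableOn (by simp) (t, θ) ⟨ht, mem_univ θ⟩).hasFDerivWithinAt
  have hγ : HasDerivWithinAt (fun θ' : ℝ => (t, θ')) ((0 : ℝ), (1 : ℝ)) univ θ :=
    ((hasDerivAt_const θ t).prodMk (hasDerivAt_id θ)).hasDerivWithinAt
  exact hasDerivWithinAt_univ.1
    (h.comp_hasDerivWithinAt (f := fun θ' : ℝ => (t, θ')) θ hγ (fun x _ => ⟨ht, mem_univ _⟩))

theorem partialT_eq_fderivWithin (hT : 0 < T)
    (hF : ContDiffOn ℝ ∞ (fun p : ℝ × ℝ => F p.1 p.2) (Icc 0 T ×ˢ univ))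
    {t : ℝ} (ht : t ∈ Icc 0 T) (θ : ℝ) : partialT T F t θ =
      fderivWithin ℝ (fun p : ℝ × ℝ => F p.1 p.2) (Icc 0 T ×ˢ univ) (t, θ) (1, 0) :=
  (hasDerivWithinAt_partialT hF ht θ).derivWithin (uniqueDiffOn_Icc hT t ht)

theorem partialθ_eq_fderivWithin
    (hF : ContDiffOn ℝ ∞ (fun p : ℝ × ℝ => F p.1 p.2) (Icc 0 T ×ˢ univ))
    {t : ℝ} (ht : t ∈ Icc 0 T) (θ : ℝ) : partialθ F t θ =
      fderivWithin ℝ (fun p : ℝ × ℝ => F p.1 p.2) (Icc 0 T ×ˢ univ) (t, θ) (0, 1) :=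
  (hasDerivAt_partialθ hF ht θ).deriv

theorem contDiffOn_fderivWithin_strip (hT : 0 < T)
    (hF : ContDiffOn ℝ ∞ (fun p : ℝ × ℝ => F p.1 p.2) (Icc 0 T ×ˢ univ)) (v : ℝ × ℝ) :
    ContDiffOn ℝ ∞ (fun p =>
      fderivWithin ℝ (fun p : ℝ × ℝ => F p.1 p.2) (Icc 0 T ×ˢ univ) p v) (Icc 0 T ×ˢ univ) :=
  (hF.fderivWithin (uniqueDiffOn_strip hT) (by simp)).clm_apply contDiffOn_const

theorem contDiffOn_partialT (hT : 0 < T)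
    (hF : ContDiffOn ℝ ∞ (fun p : ℝ × ℝ => F p.1 p.2) (Icc 0 T ×ˢ univ)) :
    ContDiffOn ℝ ∞ (fun p : ℝ × ℝ => partialT T F p.1 p.2) (Icc 0 T ×ˢ univ) :=
  (contDiffOn_fderivWithin_strip hT hF (1, 0)).congr fun p hp =>
    partialT_eq_fderivWithin hT hF hp.1 p.2

theorem contDiffOn_partialθ (hT : 0 < T)
    (hF : ContDiffOn ℝ ∞ (fun p : ℝ × ℝ => F p.1 p.2) (Icc 0 T ×ˢ univ)) :
    ContDiffOn ℝ ∞ (fun p : ℝ × ℝ => partialθ F p.1 p.2) (Icc 0 T ×ˢ univ) :=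
  (contDiffOn_fderivWithin_strip hT hF (0, 1)).congr fun p hp =>
    partialθ_eq_fderivWithin hF hp.1 p.2

theorem continuous_slice
    (hF : ContDiffOn ℝ ∞ (fun p : ℝ × ℝ => F p.1 p.2) (Icc 0 T ×ˢ univ))
    {t : ℝ} (ht : t ∈ Icc 0 T) : Continuous (F t) := by
  have : Continuous fun θ : ℝ => (t, θ) := by fun_prop
  exact hF.continuousOn.comp_continuous this fun θ => ⟨ht, mem_univ θ⟩

end calculus

/-- Differentiation under the integral sign, up to the boundary. -/
theorem hasDerivWithinAt_integral {T a b : ℝ} {G G' : ℝ → ℝ → ℝ}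
    (hG : ∀ t ∈ Icc 0 T, Continuous (G t))
    (hd : ∀ t ∈ Icc 0 T, ∀ θ, HasDerivWithinAt (fun t' => G t' θ) (G' t θ) (Icc 0 T) t)
    (hG' : ContinuousOn (fun p : ℝ × ℝ => G' p.1 p.2) (Icc 0 T ×ˢ univ))
    {t : ℝ} (ht : t ∈ Icc 0 T) :
    HasDerivWithinAt (fun t' => ∫ θ in a..b, G t' θ) (∫ θ in a..b, G' t θ) (Icc 0 T) t := by
  have hK : IsCompact (Icc (0 : ℝ) T ×ˢ uIcc a b) := isCompact_Icc.prod isCompact_uIcc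
  obtain ⟨M, hM⟩ := hK.exists_bound_of_continuousOn
    (hG'.mono (prod_mono_right (subset_univ _)))
  rw [hasDerivWithinAt_iff_tendsto_slope]
  have hev : ∀ᶠ t' in 𝓝[Icc 0 T \ {t}] t, t' ∈ Icc 0 T := by
    filter_upwards [self_mem_nhdsWithin] with t' h using h.1
  have hslope : ∀ t' ∈ Icc 0 T, slope (fun t' => ∫ θ in a..b, G t' θ) t t' =
      ∫ θ in a..b, slope (fun t' => G t' θ) t t' := by
    intro t' ht'
    simp only [slope_def_field]
    rw [intervalIntegral.integral_div, intervalIntegral.integral_sub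
      ((hG t' ht').intervalIntegrable _ _) ((hG t ht).intervalIntegrable _ _)]
  refine Tendsto.congr' (f₁ := fun t' => ∫ θ in a..b, slope (fun t' => G t' θ) t t')
    (by filter_upwards [hev] with t' h using (hslope t' h).symm) ?_
  refine intervalIntegral.tendsto_integral_filter_of_dominated_convergence (fun _ => M) ?_ ?_ ?_ ?_
  · filter_upwards [hev] with t' h
    refine Continuous.aestronglyMeasurable ?_
    simp only [slope_def_field]
    exact ((hG t' h).sub (hG t ht)).div_const _
  · filter_upwards [self_mem_nhdsWithin] with t' h
    refine Eventually.of_forall fun θ hθ => ?_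
    -- By the mean value inequality the difference quotients are bounded by the maximum of the
    -- t-derivative on the compact rectangle, which gives the dominating constant.
    have hb := (convex_Icc (0 : ℝ) T).norm_image_sub_le_of_norm_hasDerivWithin_le
      (f := fun t' => G t' θ) (C := M) (fun x hx => hd x hx θ)
      (fun x hx => hM (x, θ) ⟨hx, uIoc_subset_uIcc hθ⟩) ht h.1
    have hne : 0 < ‖t' - t‖ := norm_pos_iff.2 (sub_ne_zero.2 h.2)
    rw [slope_def_field, norm_div, div_le_iff₀ hne]
    exact hb
  · exact intervalIntegrable_const
  · refine Eventually.of_forall fun θ _ => ?_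
    exact hasDerivWithinAt_iff_tendsto_slope.1 (hd t ht θ)

theorem coord_of_mem {E : Type} [Zero E] {T : ℝ} (u : Cylinder T → E) {t : ℝ}
    (ht : t ∈ Icc (0 : ℝ) T) (θ : ℝ) : coord u t θ = u (⟨t, ht⟩, (θ : Real.Angle)) := by
  rw [coord, dif_pos ht]

theorem coord_two_pi {E : Type} [Zero E] {T : ℝ} (u : Cylinder T → E) (t θ : ℝ) :
    coord u t (θ + 2 * π) = coord u t θ := by
  unfold coord
  rw [Real.Angle.coe_add, Real.Angle.coe_two_pi, add_zero]

/-- A solution of `y'' = k² y` on `[0,T]` is determined by its initial values. -/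
theorem ode_solution {T k : ℝ} {c d : ℝ → ℝ}
    (hc : ∀ t ∈ Icc 0 T, HasDerivWithinAt c (d t) (Icc 0 T) t)
    (hd : ∀ t ∈ Icc 0 T, HasDerivWithinAt d (k ^ 2 * c t) (Icc 0 T) t) {t : ℝ} (ht : t ∈ Icc 0 T) :
    c t = c 0 * modeCosh k t + d 0 * modeSinh k t ∧
      d t = d 0 * modeCosh k t + c 0 * (k ^ 2 * modeSinh k t) := by
  have hT : 0 ≤ T := ht.1.trans ht.2
  have const : ∀ h : ℝ → ℝ, (∀ t ∈ Icc 0 T, HasDerivWithinAt h 0 (Icc 0 T) t) → h t = h 0 := by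
    intro h hh
    have := (convex_Icc (0 : ℝ) T).norm_image_sub_le_of_norm_hasDerivWithin_le (C := 0) hh
      (fun _ _ => norm_zero.le) (left_mem_Icc.2 hT) ht
    rwa [zero_mul, norm_le_zero_iff, sub_eq_zero] at this
  -- The two combinations are first integrals of the equation; `modeCosh_sq` is the determinant used
  -- to solve them for c and d.
  have h1 := const (fun t => c t * modeCosh k t - d t * modeSinh k t) fun t ht => by
    convert! ((hc t ht).mul (hasDerivAt_modeCosh k t).hasDerivWithinAt).sub
      ((hd t ht).mul (hasDerivAt_modeSinh k t).hasDerivWithinAt) using 1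
    ring
  have h2 := const (fun t => d t * modeCosh k t - c t * (k ^ 2 * modeSinh k t)) fun t ht => by
    convert! ((hd t ht).mul (hasDerivAt_modeCosh k t).hasDerivWithinAt).sub
      ((hc t ht).mul ((hasDerivAt_modeSinh k t).const_mul (k ^ 2)).hasDerivWithinAt) using 1
    ring
  simp only [modeCosh_zero_right, modeSinh_zero_right, mul_one, mul_zero, sub_zero] at h1 h2
  have h3 := modeCosh_sq k t
  constructor
  · rw [← h1, ← h2]
    linear_combination (-c t) * h3
  · rw [← h1, ← h2]
    linear_combination (-d t) * h3

/-! ### Separated eigenfunctions -/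

/-- The radial part of an eigenfunction of mode `k` with eigenvalue `σ`, where `a = f 0`. -/
def radial (a σ k t : ℝ) : ℝ := modeCosh k t - σ * a * modeSinh k t

/-- The derivative of `radial`. -/
def radialDeriv (a σ k t : ℝ) : ℝ := k ^ 2 * modeSinh k t - σ * a * modeCosh k t

theorem hasDerivAt_radial (a σ k t : ℝ) :
    HasDerivAt (radial a σ k) (radialDeriv a σ k t) t :=
  (hasDerivAt_modeCosh k t).sub ((hasDerivAt_modeSinh k t).const_mul (σ * a))

theorem hasDerivAt_radialDeriv (a σ k t : ℝ) :
    HasDerivAt (radialDeriv a σ k) (k ^ 2 * radial a σ k t) t := by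
  convert! ((hasDerivAt_modeSinh k t).const_mul (k ^ 2)).sub
    ((hasDerivAt_modeCosh k t).const_mul (σ * a)) using 1
  unfold radial; ring

theorem radial_zero_right (a σ k : ℝ) : radial a σ k 0 = 1 := by
  simp [radial, modeCosh_zero_right, modeSinh_zero_right]

theorem radialDeriv_zero_right (a σ k : ℝ) : radialDeriv a σ k 0 = -(σ * a) := by
  simp [radialDeriv, modeCosh_zero_right, modeSinh_zero_right]

theorem contDiff_radial (a σ k : ℝ) : ContDiff ℝ ∞ (radial a σ k) :=
  (contDiff_modeCosh k).sub (contDiff_const.mul (contDiff_modeSinh k))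

/-- The function `radial (t) * wave (θ)` on the cylinder. -/
def modeFun (T a σ : ℝ) (k : ℤ) : Cylinder T → ℝ := fun p => radial a σ k p.1 * wave k p.2

theorem coord_modeFun {T : ℝ} (a σ : ℝ) (k : ℤ) {t : ℝ} (ht : t ∈ Icc (0 : ℝ) T) (θ : ℝ) :
    coord (modeFun T a σ k) t θ = radial a σ k t * wave k θ := by
  rw [coord_of_mem _ ht]; rfl

theorem isSmooth_modeFun (T a σ : ℝ) (k : ℤ) : IsSmooth (modeFun T a σ k) := by
  have h : ContDiff ℝ ∞ (fun p : ℝ × ℝ => radial a σ k p.1 * wave k p.2) :=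
    ((contDiff_radial a σ k).comp contDiff_fst).mul ((contDiff_wave k).comp contDiff_snd)
  exact h.contDiffOn.congr fun p hp => coord_modeFun a σ k hp.1 p.2

theorem isEigenfunction_modeFun {T : ℝ} (hT : 0 < T) {f : ℝ → ℝ} (hf : IsConformalFactor T f)
    {σ : ℝ} {k : ℤ} (h : radialDeriv (f 0) σ k T = σ * f T * radial (f 0) σ k T) :
    IsEigenfunction f σ (modeFun T (f 0) σ k) := by
  have h0 : (0 : ℝ) ∈ Icc 0 T := left_mem_Icc.2 hT.le
  have hTm : T ∈ Icc 0 T := right_mem_Icc.2 hT.le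
  have hdt : ∀ t ∈ Icc 0 T, ∀ θ, partialT T (coord (modeFun T (f 0) σ k)) t θ =
      radialDeriv (f 0) σ k t * wave k θ := fun t ht θ =>
    partialT_eq hT ht (fun t ht => coord_modeFun _ σ k ht θ)
      ((hasDerivAt_radial (f 0) σ k t).mul_const _)
  have hdtt : ∀ t ∈ Icc 0 T, ∀ θ, partialT T (partialT T (coord (modeFun T (f 0) σ k))) t θ =
      k ^ 2 * radial (f 0) σ k t * wave k θ := fun t ht θ =>
    partialT_eq hT ht (fun t ht => hdt t ht θ) ((hasDerivAt_radialDeriv (f 0) σ k t).mul_const _)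
  have hdθ : ∀ t ∈ Icc 0 T, ∀ θ, partialθ (coord (modeFun T (f 0) σ k)) t θ =
      radial (f 0) σ k t * (k * wave (-k) θ) := fun t ht θ =>
    partialθ_eq (fun θ => coord_modeFun _ σ k ht θ) ((hasDerivAt_wave k θ).const_mul _)
  have hdθθ : ∀ t ∈ Icc 0 T, ∀ θ, partialθ (partialθ (coord (modeFun T (f 0) σ k))) t θ =
      radial (f 0) σ k t * (k * ((-k : ℤ) * wave (- -k) θ)) := fun t ht θ =>
    partialθ_eq (fun θ => hdθ t ht θ) (((hasDerivAt_wave (-k) θ).const_mul _).const_mul _)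
  refine ⟨isSmooth_modeFun T _ σ k, fun t ht θ => ?_, fun θ => ?_, fun θ => ?_⟩
  · rw [laplacian, hdtt t ht, hdθθ t ht, neg_neg]
    push_cast
    ring
  · have := hf.pos 0 h0
    rw [normalDerivLeft, hdt 0 h0, coord_modeFun _ σ k h0, radial_zero_right,
      radialDeriv_zero_right]
    field_simp
  · have := hf.pos T hTm
    rw [normalDerivRight, hdt T hTm, coord_modeFun _ σ k hTm, h]
    field_simp

/-! ### Fourier coefficients of eigenfunctions -/

/-- The Fourier coefficient of `u` of mode `k` along the circle at height `t`. -/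
def fourierMode {T : ℝ} (u : Cylinder T → ℝ) (k : ℤ) (t : ℝ) : ℝ :=
  ∫ θ in (0 : ℝ)..2 * π, coord u t θ * wave k θ

theorem hasDerivWithinAt_integral_mul_wave {T : ℝ} (hT : 0 < T) {F : ℝ → ℝ → ℝ}
    (hF : ContDiffOn ℝ ∞ (fun p : ℝ × ℝ => F p.1 p.2) (Icc 0 T ×ˢ univ)) (k : ℤ)
    {t : ℝ} (ht : t ∈ Icc 0 T) :
    HasDerivWithinAt (fun t => ∫ θ in (0 : ℝ)..2 * π, F t θ * wave k θ)
      (∫ θ in (0 : ℝ)..2 * π, partialT T F t θ * wave k θ) (Icc 0 T) t := by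
  refine hasDerivWithinAt_integral (G := fun t θ => F t θ * wave k θ)
    (G' := fun t θ => partialT T F t θ * wave k θ)
    (fun t ht => (continuous_slice hF ht).mul (continuous_wave k)) (fun t ht θ => ?_) ?_ ht
  · rw [partialT_eq_fderivWithin hT hF ht]
    exact (hasDerivWithinAt_partialT hF ht θ).mul_const _
  · exact (contDiffOn_partialT hT hF).continuousOn.mul
      ((continuous_wave k).comp continuous_snd).continuousOn

theorem partialθ_two_pi {T : ℝ} (u : Cylinder T → ℝ) (t : ℝ) :
    partialθ (coord u) t (2 * π) = partialθ (coord u) t 0 := by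
  have h : (fun θ => coord u t θ) = fun θ => coord u t (θ + 2 * π) :=
    funext fun θ => (coord_two_pi u t θ).symm
  have := deriv_comp_add_const (fun θ => coord u t θ) (2 * π) 0
  rw [zero_add] at this
  rw [partialθ, partialθ, ← this]
  congr 1
  exact h.symm

theorem integral_partialθθ_mul_wave {T : ℝ} (hT : 0 < T) {u : Cylinder T → ℝ} (hu : IsSmooth u)
    (k : ℤ) {t : ℝ} (ht : t ∈ Icc 0 T) :
    ∫ θ in (0 : ℝ)..2 * π, partialθ (partialθ (coord u)) t θ * wave k θ =
      -(k ^ 2 * fourierMode u k t) := by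
  have h1 := contDiffOn_partialθ hT hu
  have hc0 := continuous_slice hu ht
  have hc2 := continuous_slice (contDiffOn_partialθ hT h1) ht
  have hd0 : ∀ θ, HasDerivAt (fun θ => coord u t θ) (partialθ (coord u) t θ) θ := fun θ => by
    rw [partialθ_eq_fderivWithin hu ht]; exact hasDerivAt_partialθ hu ht θ
  have hd1 : ∀ θ, HasDerivAt (fun θ => partialθ (coord u) t θ)
      (partialθ (partialθ (coord u)) t θ) θ := fun θ => by
    rw [partialθ_eq_fderivWithin h1 ht]; exact hasDerivAt_partialθ h1 ht θ
  have hw : ∀ θ : ℝ, HasDerivAt (fun θ : ℝ => k * wave (-k) θ) (-(k ^ 2 * wave k θ)) θ := fun θ => by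
    convert! (hasDerivAt_wave (-k) θ).const_mul (k : ℝ) using 1
    rw [neg_neg]; push_cast; ring
  -- Two integrations by parts in one antiderivative; its boundary terms cancel by periodicity.
  have hH : ∀ θ ∈ uIcc 0 (2 * π), HasDerivAt
      (fun θ : ℝ => partialθ (coord u) t θ * wave k θ - coord u t θ * (k * wave (-k) θ))
      (partialθ (partialθ (coord u)) t θ * wave k θ + k ^ 2 * (coord u t θ * wave k θ)) θ :=
    fun θ _ => by
      convert! ((hd1 θ).mul (hasDerivAt_wave k θ)).sub ((hd0 θ).mul (hw θ)) using 1
      ring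
  have hi2 : IntervalIntegrable (fun θ : ℝ => partialθ (partialθ (coord u)) t θ * wave k θ)
      volume 0 (2 * π) := (hc2.mul (continuous_wave k)).intervalIntegrable _ _
  have hi0 : IntervalIntegrable (fun θ : ℝ => (k : ℝ) ^ 2 * (coord u t θ * wave k θ))
      volume 0 (2 * π) :=
    (continuous_const.mul (hc0.mul (continuous_wave k))).intervalIntegrable _ _
  have := intervalIntegral.integral_eq_sub_of_hasDerivAt hH (hi2.add hi0)
  have hper : coord u t (2 * π) = coord u t 0 := by simpa using coord_two_pi u t 0
  rw [intervalIntegral.integral_add hi2 hi0, intervalIntegral.integral_const_mul, partialθ_two_pi,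
    hper, wave_two_pi, wave_two_pi, sub_self] at this
  unfold fourierMode
  linarith

/-- Projecting on a wave turns the Laplace equation into y'' = k²y. The condition at t = 0 fixes the
solution up to its initial value, and the condition at t = T forces that value to vanish unless σ
satisfies the boundary equation of mode k. -/
theorem fourierMode_eigenfunction {T : ℝ} (hT : 0 < T) {f : ℝ → ℝ} (hf : IsConformalFactor T f)
    {σ : ℝ} {u : Cylinder T → ℝ} (hu : IsEigenfunction f σ u) (k : ℤ) :
    (∀ t ∈ Icc 0 T, fourierMode u k t = fourierMode u k 0 * radial (f 0) σ k t) ∧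
      (fourierMode u k 0 = 0 ∨ radialDeriv (f 0) σ k T = σ * f T * radial (f 0) σ k T) := by
  have h0 : (0 : ℝ) ∈ Icc 0 T := left_mem_Icc.2 hT.le
  have hTm : T ∈ Icc 0 T := right_mem_Icc.2 hT.le
  have hs := hu.smooth
  have h1 := contDiffOn_partialT hT hs
  set d : ℝ → ℝ := fun t => ∫ θ in (0 : ℝ)..2 * π, partialT T (coord u) t θ * wave k θ with hd
  have hlap : ∀ t ∈ Icc 0 T, ∀ θ, partialT T (partialT T (coord u)) t θ =
      -partialθ (partialθ (coord u)) t θ := by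
    intro t ht θ
    have h := hu.harmonic t ht θ
    have hp := hf.pos t ht
    have := (mul_eq_zero.1 h).resolve_left (by positivity)
    linarith
  have hc' : ∀ t ∈ Icc 0 T, HasDerivWithinAt (fourierMode u k) (d t) (Icc 0 T) t := fun t ht =>
    hasDerivWithinAt_integral_mul_wave hT hs k ht
  have hd' : ∀ t ∈ Icc 0 T, HasDerivWithinAt d ((k : ℝ) ^ 2 * fourierMode u k t) (Icc 0 T) t := by
    intro t ht
    have := hasDerivWithinAt_integral_mul_wave hT h1 k ht
    simp only [hlap t ht, neg_mul] at this
    rwa [intervalIntegral.integral_neg, integral_partialθθ_mul_wave hT hs k ht, neg_neg] at this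
  have hleft : d 0 = -(σ * f 0 * fourierMode u k 0) := by
    have hp := hf.pos 0 h0
    have : ∀ θ, partialT T (coord u) 0 θ = -(σ * f 0) * coord u 0 θ := fun θ => by
      have h := hu.left θ
      rw [normalDerivLeft] at h
      field_simp at h
      linarith
    simp only [hd, this, mul_assoc, intervalIntegral.integral_const_mul]
    unfold fourierMode
    ring
  have hright : d T = σ * f T * fourierMode u k T := by
    have hp := hf.pos T hTm
    have : ∀ θ, partialT T (coord u) T θ = (σ * f T) * coord u T θ := fun θ => by
      have h := hu.right θ
      rw [normalDerivRight] at h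
      field_simp at h
      linarith
    simp only [hd, this, mul_assoc, intervalIntegral.integral_const_mul]
    unfold fourierMode
    ring
  have hsol : ∀ t ∈ Icc 0 T, fourierMode u k t = fourierMode u k 0 * radial (f 0) σ k t := by
    intro t ht
    rw [(ode_solution hc' hd' ht).1, hleft, radial]
    ring
  refine ⟨hsol, ?_⟩
  have hdT := (ode_solution hc' hd' hTm).2
  rw [hright, hsol T hTm, hleft] at hdT
  have : fourierMode u k 0 *
      (radialDeriv (f 0) σ k T - σ * f T * radial (f 0) σ k T) = 0 := by
    unfold radialDeriv
    linarith
  rcases mul_eq_zero.1 this with h | h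
  · exact Or.inl h
  · exact Or.inr (by linarith)

/-- A continuous function on the circle whose Fourier coefficients vanish is zero. -/
theorem eq_zero_of_integral_mul_wave {φ : Real.Angle → ℝ} (hφ : Continuous fun θ : ℝ => φ θ)
    (h : ∀ k : ℤ, ∫ θ in (0 : ℝ)..2 * π, φ θ * wave k θ = 0) : φ = 0 := by
  have : Fact (0 < 2 * π) := ⟨by positivity⟩
  have hcos : ∀ n : ℤ, ∫ θ in (0 : ℝ)..2 * π, φ θ * Real.cos (n * θ) = 0 := by
    intro n
    rcases le_total 0 n with hn | hn
    · simpa only [wave_of_nonneg hn] using h n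
    · have := h (-n)
      simp only [wave_of_nonneg (neg_nonneg.2 hn), Int.cast_neg, neg_mul, Real.cos_neg] at this
      exact this
  have hsin : ∀ n : ℤ, ∫ θ in (0 : ℝ)..2 * π, φ θ * Real.sin (n * θ) = 0 := by
    intro n
    rcases lt_trichotomy n 0 with hn | hn | hn
    · simpa only [wave_of_neg hn] using h n
    · simp [hn]
    · have := h (-n)
      simp only [wave_of_neg (neg_lt_zero.2 hn), Int.cast_neg, neg_mul, Real.sin_neg, mul_neg,
        intervalIntegral.integral_neg, neg_eq_zero] at this
      exact this
  have hcont : Continuous (fun x : AddCircle (2 * π) => ((φ x : ℝ) : ℂ)) := by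
    refine Complex.continuous_ofReal.comp ?_
    exact (QuotientAddGroup.isQuotientMap_mk _).continuous_iff.2 hφ
  let F : C(AddCircle (2 * π), ℂ) := ⟨fun x => ((φ x : ℝ) : ℂ), hcont⟩
  have hzero : fourierCoeff F = 0 := by
    ext n
    rw [fourierCoeff_eq_intervalIntegral F n 0, zero_add]
    have hint : ∀ x : ℝ, fourier (-n) (x : AddCircle (2 * π)) • F (x : AddCircle (2 * π)) =
        ((φ x * Real.cos (n * x) : ℝ) : ℂ) - Complex.I * ((φ x * Real.sin (n * x) : ℝ) : ℂ) := by
      intro x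
      rw [fourier_coe_apply]
      have e : 2 * (π : ℂ) * Complex.I * ((-n : ℤ) : ℂ) * x / ((2 * π : ℝ) : ℂ) =
          ((-(n * x) : ℝ) : ℂ) * Complex.I := by
        push_cast
        have : (π : ℂ) ≠ 0 := by exact_mod_cast Real.pi_ne_zero
        field_simp
      rw [e, Complex.exp_mul_I, ← Complex.ofReal_cos, ← Complex.ofReal_sin, Real.cos_neg,
        Real.sin_neg]
      change _ * ((φ x : ℝ) : ℂ) = _
      push_cast
      ring
    simp_rw [hint]
    have hc1 : Continuous fun x : ℝ => φ x * Real.cos (n * x) := hφ.mul (by fun_prop)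
    have hc2 : Continuous fun x : ℝ => φ x * Real.sin (n * x) := hφ.mul (by fun_prop)
    have hi1 : IntervalIntegrable (fun x : ℝ => ((φ x * Real.cos (n * x) : ℝ) : ℂ)) volume 0 (2 * π) :=
      (Complex.continuous_ofReal.comp hc1).intervalIntegrable _ _
    have hi2 : IntervalIntegrable
        (fun x : ℝ => Complex.I * ((φ x * Real.sin (n * x) : ℝ) : ℂ)) volume 0 (2 * π) :=
      (continuous_const.mul (Complex.continuous_ofReal.comp hc2)).intervalIntegrable _ _
    rw [intervalIntegral.integral_sub hi1 hi2,
      intervalIntegral.integral_const_mul, intervalIntegral.integral_ofReal,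
      intervalIntegral.integral_ofReal, hcos, hsin]
    simp
  -- Zero coefficients are summable, so the Fourier series converges pointwise to φ although φ is
  -- only assumed continuous.
  have hsum : Summable (fourierCoeff F) := by rw [hzero]; exact summable_zero
  funext x
  have h1 := has_pointwise_sum_fourier_series_of_summable hsum x
  simp only [hzero, Pi.zero_apply, zero_smul] at h1
  have h2 : F x = 0 := h1.unique hasSum_zero
  have h3 : ((φ x : ℝ) : ℂ) = 0 := h2
  exact_mod_cast h3

theorem eq_zero_of_fourierMode {T : ℝ} {v : Cylinder T → ℝ} (hv : IsSmooth v)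
    (h : ∀ k : ℤ, ∀ t ∈ Icc 0 T, fourierMode v k t = 0) : v = 0 := by
  funext ⟨⟨t, ht⟩, θ⟩
  have hc := continuous_slice hv ht
  have := eq_zero_of_integral_mul_wave (φ := fun θ => v (⟨t, ht⟩, θ))
    (hc.congr fun θ => coord_of_mem v ht θ) fun k => by
      have := h k t ht
      unfold fourierMode at this
      simpa only [coord_of_mem v ht] using this
  exact congrFun this θ

/-! ### Enumerating values with finite sublevel sets -/

section enumeration

variable {ι : Type} {val : ι → ℝ}

/-- Taking the largest value in s replaces an arbitrary threshold by one that is attained, so that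
infima of thresholds become minima over finite sets. -/
theorem exists_value_le (hfin : ∀ c, {i | val i ≤ c}.Finite) {k : ℕ} {s : Set ι} {c : ℝ}
    (hs : s ⊆ {i | val i ≤ c}) (hk : k < s.ncard) :
    ∃ i ∈ s, k < {j | val j ≤ val i}.ncard := by
  have hsf := (hfin c).subset hs
  have hne : s.Nonempty := by
    rw [← Set.ncard_pos hsf]; lia
  obtain ⟨i, hi, hmax⟩ := Set.exists_max_image s val hsf hne
  exact ⟨i, hi, hk.trans_le (Set.ncard_le_ncard hmax (hfin _))⟩

theorem exists_isLeast_lt_ncard [Infinite ι] (hfin : ∀ c, {i | val i ≤ c}.Finite) (k : ℕ) :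
    ∃ e, IsLeast {c | k < {i | val i ≤ c}.ncard} e ∧ {i | val i < e}.ncard ≤ k := by
  obtain ⟨t, ht⟩ := Infinite.exists_subset_card_eq ι (k + 1)
  obtain ⟨c, hc⟩ := (t.image val).exists_le
  have hck : k < {i | val i ≤ c}.ncard := by
    have h1 : (t : Set ι) ⊆ {i | val i ≤ c} := fun i hi =>
      hc _ (Finset.mem_image_of_mem val hi)
    have := Set.ncard_le_ncard h1 (hfin c)
    rw [Set.ncard_coe_finset, ht] at this
    lia
  obtain ⟨i₀, hi₀, hk₀⟩ := exists_value_le hfin Subset.rfl hck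
  obtain ⟨i, hi, hmin⟩ := Set.exists_min_image {i | val i ≤ c ∧ k < {j | val j ≤ val i}.ncard} val
    ((hfin c).subset fun _ h => h.1) ⟨i₀, hi₀, hk₀⟩
  have hleast : IsLeast {c | k < {i | val i ≤ c}.ncard} (val i) := by
    refine ⟨hi.2, fun c' hc' => ?_⟩
    obtain ⟨j, hj, hjk⟩ := exists_value_le hfin Subset.rfl hc'
    rcases le_total (val j) c with h | h
    · exact (hmin j ⟨h, hjk⟩).trans hj
    · exact hi.1.trans (h.trans hj)
  refine ⟨val i, hleast, ?_⟩
  by_contra! hcon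
  obtain ⟨j, hj, hjk⟩ := exists_value_le hfin (c := val i) (s := {j | val j < val i})
    (fun _ h => le_of_lt (show val _ < val i from h)) hcon
  exact absurd (hleast.2 hjk) (not_le.2 hj)

end enumeration

/-! ### The Steklov spectrum -/

/-- The quantity `4 a b / (a + b)²`, which is `1` precisely for `a = b`. -/
def balance (a b : ℝ) : ℝ := 4 * a * b / (a + b) ^ 2

theorem balance_pos {a b : ℝ} (ha : 0 < a) (hb : 0 < b) : 0 < balance a b := by
  unfold balance; positivity

theorem balance_le_one {a b : ℝ} (ha : 0 < a) (hb : 0 < b) : balance a b ≤ 1 := by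
  unfold balance
  rw [div_le_one (by positivity)]
  nlinarith [sq_nonneg (a - b)]

theorem balance_eq_one_iff {a b : ℝ} (ha : 0 < a) (hb : 0 < b) : balance a b = 1 ↔ a = b := by
  unfold balance
  rw [div_eq_one_iff_eq (by positivity)]
  constructor
  · intro h
    have : (a - b) ^ 2 = 0 := by linarith
    exact sub_eq_zero.1 (pow_eq_zero_iff two_ne_zero |>.1 this)
  · rintro rfl; ring

/-- The normalized Steklov eigenvalues, indexed by the mode and by the choice of the root. -/
def normalizedRoot (r T : ℝ) (i : ℤ × Bool) : ℝ :=
  if i.2 then highRoot r T i.1 else lowRoot r T i.1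

/-- The Steklov eigenvalues, indexed by the mode and by the choice of the root. -/
def steklovValue (T : ℝ) (f : ℝ → ℝ) (i : ℤ × Bool) : ℝ :=
  2 / (f 0 + f T) * normalizedRoot (balance (f 0) (f T)) T i

/-- The Steklov eigenfunctions, indexed by the mode and by the choice of the root. -/
def steklovFun (T : ℝ) (f : ℝ → ℝ) (i : ℤ × Bool) : Cylinder T → ℝ :=
  modeFun T (f 0) (steklovValue T f i) i.1

section spectrum

variable {T : ℝ} {f : ℝ → ℝ}

theorem IsConformalFactor.pos_left (hf : IsConformalFactor T f) (hT : 0 < T) : 0 < f 0 :=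
  hf.pos 0 (left_mem_Icc.2 hT.le)

theorem IsConformalFactor.pos_right (hf : IsConformalFactor T f) (hT : 0 < T) : 0 < f T :=
  hf.pos T (right_mem_Icc.2 hT.le)

/-- Substituting σ = 2ν/(f 0 + f T) and dividing by `modeCosh k T` turns the condition at t = T into
the quadratic whose roots are `lowRoot` and `highRoot`; the metric enters only through `balance`. -/
theorem boundary_condition_iff (hT : 0 < T) (hf : IsConformalFactor T f) (σ : ℝ) (k : ℤ) :
    radialDeriv (f 0) σ k T = σ * f T * radial (f 0) σ k T ↔ ∃ b, σ = steklovValue T f (k, b) := by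
  have ha := hf.pos_left hT
  have hb := hf.pos_right hT
  have hC := modeCosh_pos k T
  obtain ⟨ν, hν⟩ : ∃ ν, σ = 2 / (f 0 + f T) * ν := ⟨(f 0 + f T) / 2 * σ, by field_simp⟩
  have h1 : radialDeriv (f 0) σ k T - σ * f T * radial (f 0) σ k T = modeCosh k T *
      (balance (f 0) (f T) * ratio T k * ν ^ 2 - 2 * ν + k ^ 2 * ratio T k) := by
    rw [radialDeriv, radial, ratio, balance, hν]
    field_simp
    ring
  have h2 : ∀ x, 2 / (f 0 + f T) * ν = 2 / (f 0 + f T) * x ↔ ν = x := fun x =>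
    mul_right_inj' (by positivity)
  rw [← sub_eq_zero, h1, mul_eq_zero, or_iff_right hC.ne',
    root_iff (balance_pos ha hb) (balance_le_one ha hb) hT, Bool.exists_bool, hν]
  simp only [steklovValue, normalizedRoot, h2]
  simp

theorem steklovValue_lt (hT : 0 < T) (hf : IsConformalFactor T f) (k : ℤ) :
    steklovValue T f (k, false) < steklovValue T f (k, true) := by
  have ha := hf.pos_left hT
  have hb := hf.pos_right hT
  have := lowRoot_lt_highRoot (balance_pos ha hb) (balance_le_one ha hb) hT k
  simp only [steklovValue, normalizedRoot]
  simpa using mul_lt_mul_of_pos_left this (show 0 < 2 / (f 0 + f T) by positivity)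

/-- The two roots of a mode are distinct, so a given eigenvalue uses each mode at most once. -/
theorem steklovValue_fst_injective (hT : 0 < T) (hf : IsConformalFactor T f) {i j : ℤ × Bool}
    (h1 : i.1 = j.1) (h2 : steklovValue T f i = steklovValue T f j) : i = j := by
  obtain ⟨k, b⟩ := i
  obtain ⟨l, c⟩ := j
  obtain rfl : k = l := h1
  have := steklovValue_lt hT hf k
  cases b <;> cases c <;> first | rfl | (exfalso; linarith)

theorem lowRoot_le_normalizedRoot {r : ℝ} (hr : 0 < r) (hr1 : r ≤ 1) (hT : 0 < T) (i : ℤ × Bool) :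
    lowRoot r T i.1 ≤ normalizedRoot r T i := by
  unfold normalizedRoot
  split_ifs
  · exact (lowRoot_lt_highRoot hr hr1 hT _).le
  · exact le_rfl

theorem finite_steklovValue_le (hT : 0 < T) (hf : IsConformalFactor T f) (c : ℝ) :
    {i | steklovValue T f i ≤ c}.Finite := by
  have ha := hf.pos_left hT
  have hb := hf.pos_right hT
  have ht := tanh_pos hT
  -- This bound comes from solving the linear lower bound `le_lowRoot` for |k|.
  obtain ⟨N, hN⟩ := exists_nat_ge ((f 0 + f T) * c / Real.tanh T)
  refine ((Set.finite_Icc (-(N + 1) : ℤ) (N + 1)).prod (Set.finite_univ (α := Bool))).subset ?_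
  rintro ⟨k, b⟩ h
  refine ⟨abs_le.1 ?_, mem_univ _⟩
  by_contra! hk
  simp only at hk
  have hk1 : (N : ℝ) + 1 < |(k : ℝ)| := by exact_mod_cast hk
  have hN0 : (0 : ℝ) ≤ N := by positivity
  have h1 := le_lowRoot (balance_pos ha hb) hT (k := k) (by linarith)
  have h2 := lowRoot_le_normalizedRoot (balance_pos ha hb) (balance_le_one ha hb) hT (k, b)
  have h3 : 2 / (f 0 + f T) * (|(k : ℝ)| * Real.tanh T / 2) ≤ c :=
    (mul_le_mul_of_nonneg_left (h1.trans h2) (by positivity)).trans h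
  rw [div_le_iff₀ ht] at hN
  have h4 : |(k : ℝ)| * Real.tanh T ≤ (f 0 + f T) * c := by
    have := mul_le_mul_of_nonneg_left h3 (show 0 ≤ f 0 + f T by positivity)
    field_simp at this
    linarith
  nlinarith

theorem isEigenfunction_steklovFun (hT : 0 < T) (hf : IsConformalFactor T f) (i : ℤ × Bool) :
    IsEigenfunction f (steklovValue T f i) (steklovFun T f i) :=
  isEigenfunction_modeFun hT hf ((boundary_condition_iff hT hf _ _).2 ⟨i.2, rfl⟩)

theorem coord_sum {ι : Type} (s : Finset ι) (a : ι → ℝ) (v : ι → Cylinder T → ℝ) (t θ : ℝ) :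
    coord (∑ i ∈ s, a i • v i) t θ = ∑ i ∈ s, a i * coord (v i) t θ := by
  unfold coord
  split_ifs with h
  · simp
  · simp

theorem fourierMode_sum_steklovFun (s : Finset (ℤ × Bool)) (a : ℤ × Bool → ℝ) (l : ℤ) {t : ℝ}
    (ht : t ∈ Icc 0 T) :
    fourierMode (∑ i ∈ s, a i • steklovFun T f i) l t = ∑ i ∈ s, if i.1 = l then
      a i * radial (f 0) (steklovValue T f i) i.1 t *
        ∫ θ in (0 : ℝ)..2 * π, wave l θ * wave l θ else 0 := by
  unfold fourierMode
  simp only [coord_sum, Finset.sum_mul, steklovFun, coord_modeFun _ _ _ ht]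
  have hc : ∀ i : ℤ × Bool, Continuous fun θ : ℝ =>
      a i * radial (f 0) (steklovValue T f i) i.1 t * (wave i.1 θ * wave l θ) := fun i =>
    continuous_const.mul ((continuous_wave _).mul (continuous_wave _))
  have hassoc : ∀ (i : ℤ × Bool) (θ : ℝ),
      a i * (radial (f 0) (steklovValue T f i) i.1 t * wave i.1 θ) * wave l θ =
        a i * radial (f 0) (steklovValue T f i) i.1 t * (wave i.1 θ * wave l θ) := fun i θ => by
    ring
  simp only [hassoc]
  rw [intervalIntegral.integral_finsetSum fun i _ => (hc i).intervalIntegrable _ _]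
  refine Finset.sum_congr rfl fun i _ => ?_
  rw [intervalIntegral.integral_const_mul]
  split_ifs with h
  · rw [h]
  · rw [integral_wave_mul_wave_of_ne h, mul_zero]

/-- Orthogonality of waves isolates one mode. Its two radial parts agree at t = 0 but differ at t =
T, because the two roots are distinct. -/
theorem linearIndependent_steklovFun (hT : 0 < T) (hf : IsConformalFactor T f) :
    LinearIndependent ℝ (steklovFun T f) := by
  rw [linearIndependent_iff']
  intro s a h0
  have ha := hf.pos_left hT
  have hmode : ∀ l : ℤ, ∀ t ∈ Icc 0 T, ∑ i ∈ s, (if i.1 = l then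
      a i * radial (f 0) (steklovValue T f i) i.1 t else 0) = 0 := by
    intro l t ht
    have h1 := fourierMode_sum_steklovFun (f := f) s a l ht
    rw [h0] at h1
    have h2 : fourierMode (0 : Cylinder T → ℝ) l t = 0 := by
      simp [fourierMode, coord]
    rw [h2] at h1
    have hN := integral_wave_mul_self_pos l
    have h3 : (∑ i ∈ s, (if i.1 = l then
        a i * radial (f 0) (steklovValue T f i) i.1 t else 0)) *
          ∫ θ in (0 : ℝ)..2 * π, wave l θ * wave l θ = 0 := by
      rw [Finset.sum_mul]
      refine Eq.trans (Finset.sum_congr rfl fun i _ => ?_) h1.symm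
      split_ifs
      · rfl
      · rw [zero_mul]
    exact (mul_eq_zero.1 h3).resolve_right hN.ne'
  -- Extension by zero lets both indices of a mode be treated together, whether or not they lie in
  -- s.
  set c : ℤ × Bool → ℝ := fun i => if i ∈ s then a i else 0 with hc
  have hpair : ∀ l : ℤ, ∀ t ∈ Icc 0 T,
      c (l, false) * radial (f 0) (steklovValue T f (l, false)) l t +
        c (l, true) * radial (f 0) (steklovValue T f (l, true)) l t = 0 := by
    intro l t ht
    have h1 := hmode l t ht
    set t' : Finset (ℤ × Bool) := {(l, false), (l, true)} with ht'
    have h2 : ∑ i ∈ s, (if i.1 = l then a i * radial (f 0) (steklovValue T f i) i.1 t else 0) =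
        ∑ i ∈ s ∪ t', (if i.1 = l then c i * radial (f 0) (steklovValue T f i) i.1 t else 0) := by
      rw [← Finset.sum_subset Finset.subset_union_left]
      · exact Finset.sum_congr rfl fun i hi => by simp [hc, hi]
      · intro i _ hi
        simp [hc, hi]
    have h3 : ∑ i ∈ t', (if i.1 = l then c i * radial (f 0) (steklovValue T f i) i.1 t else 0) =
        ∑ i ∈ s ∪ t', (if i.1 = l then c i * radial (f 0) (steklovValue T f i) i.1 t else 0) := by
      refine Finset.sum_subset Finset.subset_union_right ?_
      rintro ⟨k, b⟩ _ hi
      rw [if_neg]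
      rintro rfl
      cases b <;> simp [ht'] at hi
    rw [h2, ← h3, Finset.sum_pair (by simp)] at h1
    simpa using h1
  have hzero : ∀ l : ℤ, c (l, false) = 0 ∧ c (l, true) = 0 := by
    intro l
    have h1 := hpair l 0 (left_mem_Icc.2 hT.le)
    have h2 := hpair l T (right_mem_Icc.2 hT.le)
    rw [radial_zero_right, radial_zero_right] at h1
    have hS := modeSinh_pos (l : ℝ) hT
    have hlt := steklovValue_lt hT hf l
    have h3 : c (l, false) * ((steklovValue T f (l, true) - steklovValue T f (l, false)) *
        f 0 * modeSinh l T) = 0 := by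
      simp only [radial] at h2
      have h4 : c (l, true) = -c (l, false) := by linarith
      rw [h4] at h2
      linarith
    have h5 : c (l, false) = 0 := by
      refine (mul_eq_zero.1 h3).resolve_right ?_
      have := sub_pos.2 hlt
      positivity
    exact ⟨h5, by linarith⟩
  rintro ⟨l, b⟩ hi
  have : c (l, b) = 0 := by cases b; exacts [(hzero l).1, (hzero l).2]
  simpa [hc, hi] using this

/-- Completeness: subtracting the combination of separated solutions prescribed by the Fourier
coefficients leaves a smooth function whose Fourier coefficients vanish on every circle. -/
theorem mem_span_steklovFun (hT : 0 < T) (hf : IsConformalFactor T f) {σ : ℝ}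
    {u : Cylinder T → ℝ} (hu : IsEigenfunction f σ u) :
    u ∈ Submodule.span ℝ (steklovFun T f '' {i | steklovValue T f i = σ}) := by
  have hfin : {i | steklovValue T f i = σ}.Finite :=
    (finite_steklovValue_le hT hf σ).subset fun i h => le_of_eq h
  set A := hfin.toFinset with hA
  have hmem : ∀ i, i ∈ A ↔ steklovValue T f i = σ := fun i => by simp [hA]
  -- The coefficients are read off at t = 0, where every radial part equals 1.
  set a : ℤ × Bool → ℝ := fun i =>
    fourierMode u i.1 0 / ∫ θ in (0 : ℝ)..2 * π, wave i.1 θ * wave i.1 θ with ha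
  set w : Cylinder T → ℝ := ∑ i ∈ A, a i • steklovFun T f i with hw
  have hws : IsSmooth w := by
    have h1 : ContDiffOn ℝ ∞ (fun p : ℝ × ℝ => ∑ i ∈ A, a i * coord (steklovFun T f i) p.1 p.2)
        (Icc 0 T ×ˢ univ) := by
      refine ContDiffOn.sum fun i _ => contDiffOn_const.mul ?_
      exact isSmooth_modeFun T _ _ _
    exact h1.congr fun p _ => coord_sum A a _ _ _
  have hsub : ∀ t θ, coord (u - w) t θ = coord u t θ - coord w t θ := fun t θ => by
    unfold coord; split_ifs <;> simp
  have hvs : IsSmooth (u - w) := (hu.smooth.sub hws).congr fun p _ => hsub _ _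
  have huw : u - w = 0 := by
    refine eq_zero_of_fourierMode hvs fun l t ht => ?_
    have h1 : fourierMode (u - w) l t = fourierMode u l t - fourierMode w l t := by
      unfold fourierMode
      simp only [hsub, sub_mul]
      exact intervalIntegral.integral_sub
        (((continuous_slice hu.smooth ht).mul (continuous_wave l)).intervalIntegrable _ _)
        (((continuous_slice hws ht).mul (continuous_wave l)).intervalIntegrable _ _)
    obtain ⟨h2, h3⟩ := fourierMode_eigenfunction hT hf hu l
    rw [h1, hw, fourierMode_sum_steklovFun A a l ht, h2 t ht]
    by_cases hb : ∃ b, σ = steklovValue T f (l, b)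
    · obtain ⟨b, hb⟩ := hb
      have hN := integral_wave_mul_self_pos l
      rw [Finset.sum_eq_single (l, b)]
      · rw [if_pos rfl, ← hb, ha]
        rw [div_mul_eq_mul_div, div_mul_cancel₀ _ hN.ne', sub_self]
      · rintro ⟨k, c⟩ hi hne
        rw [if_neg]
        intro hk
        exact hne (steklovValue_fst_injective hT hf hk (((hmem _).1 hi).trans hb))
      · intro h
        exact absurd ((hmem _).2 hb.symm) h
    · have h4 : fourierMode u l 0 = 0 := by
        rcases h3 with h3 | h3
        · exact h3
        · exact absurd ((boundary_condition_iff hT hf σ l).1 h3) hb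
      rw [h4, zero_mul, zero_sub, neg_eq_zero]
      refine Finset.sum_eq_zero ?_
      rintro ⟨k, c⟩ hi
      rw [if_neg]
      rintro rfl
      exact hb ⟨c, ((hmem _).1 hi).symm⟩
  rw [sub_eq_zero.1 huw, hw]
  exact Submodule.sum_mem _ fun i hi => Submodule.smul_mem _ _
    (Submodule.subset_span ⟨i, (hmem i).1 hi, rfl⟩)

theorem eigenSpan_eq (hT : 0 < T) (hf : IsConformalFactor T f) (S : Set ℝ) :
    eigenSpan T f S = Submodule.span ℝ (steklovFun T f '' {i | steklovValue T f i ∈ S}) := by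
  refine le_antisymm (Submodule.span_le.2 ?_) (Submodule.span_mono ?_)
  · rintro u ⟨σ, hσ, hu⟩
    refine Submodule.span_mono (image_mono ?_) (mem_span_steklovFun hT hf hu)
    rintro i rfl
    exact hσ
  · rintro _ ⟨i, hi, rfl⟩
    exact ⟨_, hi, isEigenfunction_steklovFun hT hf i⟩

theorem rank_eigenSpan (hT : 0 < T) (hf : IsConformalFactor T f) {S : Set ℝ} {c : ℝ}
    (hS : S ⊆ Iic c) : Module.rank ℝ (eigenSpan T f S) =
      ({i | steklovValue T f i ∈ S}.ncard : Cardinal) := by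
  have hfin : {i | steklovValue T f i ∈ S}.Finite :=
    (finite_steklovValue_le hT hf c).subset fun i h => hS h
  have hli := linearIndependent_steklovFun hT hf
  rw [eigenSpan_eq hT hf, Set.cast_ncard hfin,
    rank_span_set (hli.linearIndepOn _).id_image, Cardinal.mk_image_eq hli.injective]

/-- Dimensions of spectral subspaces are numbers of indices, so the infimum defining the eigenvalue
is a minimum and can be located by counting. -/
theorem eigenvalue_spec (hT : 0 < T) (hf : IsConformalFactor T f) (k : ℕ) :
    IsLeast {c | k < {i | steklovValue T f i ≤ c}.ncard} (eigenvalue T f k) ∧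
      {i | steklovValue T f i < eigenvalue T f k}.ncard ≤ k := by
  obtain ⟨e, he, hek⟩ := exists_isLeast_lt_ncard (finite_steklovValue_le hT hf) k
  have : eigenvalue T f k = e := by
    rw [eigenvalue, ← he.csInf_eq]
    congr 1
    ext c
    rw [mem_ofPred_eq, rank_eigenSpan hT hf Subset.rfl]
    exact Nat.cast_lt
  rw [this]
  exact ⟨he, hek⟩

theorem isKthEigenvalue_eigenvalue (hT : 0 < T) (hf : IsConformalFactor T f) (k : ℕ) :
    IsKthEigenvalue T f k (eigenvalue T f k) := by
  obtain ⟨h1, h2⟩ := eigenvalue_spec hT hf k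
  refine ⟨?_, ?_⟩
  · rw [rank_eigenSpan hT hf Iio_subset_Iic_self]
    exact Nat.cast_le.2 h2
  · rw [rank_eigenSpan hT hf Subset.rfl]
    exact Nat.cast_lt.2 h1.1

end spectrum

/-! ### Upper bound for the normalized eigenvalues -/

section bound

variable {s : ℝ}

/-- Since 1 ≤ st, s - t ≤ (s² - 1)t ≤ (11/25)t, and likewise st - 1 ≤ (11/25)(m - 1); the first
bound follows from (11/25)² < 1/5. The second does not involve m and serves when m is large. -/
theorem one_sub_le_of_poly {r t m : ℝ} (hs : 1 < s) (hs2 : s ≤ 6 / 5) (hm : 1 < m) (ht : 0 < t)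
    (hst : 0 ≤ s * t - 1) (h : (1 - r) * t ≤ (s * t - 1) * (s - t))
    (h' : s * t - 1 ≤ (s ^ 2 - 1) * (m - 1)) : 1 - r ≤ (m - 1) / 5 ∧ 1 - r ≤ 1 / 25 := by
  have hs0 : 0 < s := by linarith
  have h7 : s ^ 2 ≤ 36 / 25 := by nlinarith
  have h8 : s - t ≤ 11 / 25 * t := by
    have h1 := mul_le_mul_of_nonneg_right h7 ht.le
    have h2 := mul_nonneg hs0.le hst
    linarith
  have h9 : s * t - 1 ≤ 11 / 25 * (m - 1) := by
    have h1 : (s ^ 2 - 1) * (m - 1) ≤ 11 / 25 * (m - 1) := by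
      gcongr
      linarith
    linarith
  constructor
  · have h10 : (1 - r) * t ≤ (m - 1) / 5 * t := by
      calc (1 - r) * t ≤ (s * t - 1) * (s - t) := h
        _ ≤ (s * t - 1) * (11 / 25 * t) := by gcongr
        _ ≤ (11 / 25 * (m - 1)) * (11 / 25 * t) := by gcongr
        _ ≤ (m - 1) / 5 * t := by
          have := mul_pos (sub_pos.2 hm) ht
          linarith
    exact le_of_mul_le_mul_right h10 ht
  -- The difference of the two sides is s(t - 1)².
  · have h1 : (s * t - 1) * (s - t) ≤ (s - 1) ^ 2 * t := by
      have := mul_nonneg hs0.le (sq_nonneg (t - 1))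
      linarith
    have h2 : (s - 1) ^ 2 ≤ 1 / 25 := by nlinarith
    have h3 := mul_le_mul_of_nonneg_right h2 ht.le
    exact le_of_mul_le_mul_right (h.trans (h1.trans h3)) ht

/-- If the low root of mode `n` is at least `n / s`, then the metric is nearly balanced. -/
theorem one_sub_le_of_le_lowRoot (hs : 1 < s) (hs2 : s ≤ 6 / 5) (hst : Real.tanh s = 1 / s)
    {n : ℕ} (hn : 1 ≤ n) {r T m : ℝ} (hm : 1 < m) (hT : T = 2 * s * m / n)
    (h : n / s ≤ lowRoot r T n) : 1 - r ≤ (m - 1) / 5 ∧ 1 - r ≤ 1 / 25 := by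
  have hs0 : 0 < s := by linarith
  have hn0 : (0 : ℝ) < n := by exact_mod_cast hn
  have hm0 : 0 < m := by linarith
  have hTpos : 0 < T := by rw [hT]; positivity
  have hnT : |(n : ℝ)| * T = 2 * (s * m) := by
    rw [abs_of_pos hn0, hT]; field_simp
  have htpos : 0 < Real.tanh (s * m) := tanh_pos (by positivity)
  have ht1 : Real.tanh (s * m) < 1 := Real.tanh_lt_one _
  -- The graph of tanh lies below its tangent line at s, whose slope is 1 - 1/s².
  have hth : Real.tanh (s * m) ≤ 1 / s + (1 - 1 / s ^ 2) * (s * (m - 1)) := by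
    have hh : 0 ≤ s * (m - 1) := mul_nonneg hs0.le (by linarith)
    have h1 := tanh_le_self hh
    have h0 := tanh_nonneg hh
    have e : s * m = s + s * (m - 1) := by ring
    rw [e, tanh_add, hst, div_le_iff₀ (by positivity)]
    have h2 : 0 ≤ 1 - 1 / s ^ 2 := by
      rw [sub_nonneg, div_le_one (by positivity)]; nlinarith
    have h3 := mul_le_mul_of_nonneg_left h1 h2
    have h4 : 0 ≤ (1 - 1 / s ^ 2) * (s * (m - 1)) * (1 / s * Real.tanh (s * (m - 1))) := by
      positivity
    have h5 : 1 / s * (1 / s) = 1 / s ^ 2 := by field_simp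
    nlinarith
  have hge : 1 / s ≤ Real.tanh (s * m) := by
    rw [← hst]; exact tanh_strictMono.monotone (by nlinarith)
  rw [lowRoot_eq hTpos, hnT, abs_of_pos hn0, tanh_two_mul] at h
  set t := Real.tanh (s * m) with ht
  set q := √(1 - r * (2 * t / (1 + t ^ 2)) ^ 2) with hq
  have hq0 : 0 ≤ q := Real.sqrt_nonneg _
  have h1 : (1 + q) * (1 + t ^ 2) ≤ s * (2 * t) := by
    rw [div_le_div_iff₀ hs0 (by positivity)] at h
    have h' : n * (1 + q) ≤ n * (2 * t / (1 + t ^ 2) * s) := by linarith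
    have := le_of_mul_le_mul_left h' hn0
    rw [div_mul_eq_mul_div, le_div_iff₀ (by positivity)] at this
    linarith
  have h2 : 1 - r * (2 * t / (1 + t ^ 2)) ^ 2 ≤ q ^ 2 := by
    rw [hq]
    rcases le_total 0 (1 - r * (2 * t / (1 + t ^ 2)) ^ 2) with h | h
    · rw [Real.sq_sqrt h]
    · exact h.trans (sq_nonneg _)
  have h3 : (1 + t ^ 2) ^ 2 - r * (2 * t) ^ 2 ≤ (q * (1 + t ^ 2)) ^ 2 := by
    have := mul_le_mul_of_nonneg_right h2 (sq_nonneg (1 + t ^ 2))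
    rw [sub_mul, div_pow, mul_assoc, div_mul_cancel₀ _ (by positivity)] at this
    linarith
  have h4 : (q * (1 + t ^ 2)) ^ 2 ≤ (s * (2 * t) - (1 + t ^ 2)) ^ 2 := by
    have : 0 ≤ q * (1 + t ^ 2) := by positivity
    gcongr
    linarith
  -- After squaring, the terms (1 + t²)² cancel and a factor 4t can be divided out.
  have h5 : (1 - r) * t ≤ (s * t - 1) * (s - t) := by
    have : 4 * t * ((1 - r) * t) ≤ 4 * t * ((s * t - 1) * (s - t)) := by nlinarith
    exact le_of_mul_le_mul_left this (by positivity)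
  have hst0 : 0 ≤ s * t - 1 := by
    rw [div_le_iff₀ hs0] at hge; linarith
  have h6 : s * t - 1 ≤ (s ^ 2 - 1) * (m - 1) := by
    have := mul_le_mul_of_nonneg_left hth hs0.le
    have e : s * (1 / s + (1 - 1 / s ^ 2) * (s * (m - 1))) = 1 + (s ^ 2 - 1) * (m - 1) := by
      field_simp
    linarith
  exact one_sub_le_of_poly hs hs2 hm htpos hst0 h5 h6

/-- With ρ = κ/T the two conditions of `highRoot_lt` at 2m/T read 1 < 2mrρ and m < ρ(m²r + y²). The
hypotheses are their squares after inserting ρ²(1 + 4y²) ≥ 1. -/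
theorem highRoot_lt_of_poly {r T m : ℝ} (hr : 0 < r) (hr1 : r ≤ 1) (hT : 0 < T) (hm : 0 < m)
    {k y : ℝ} (hy : y ^ 2 = (k * T / 2) ^ 2) (h1 : 1 + 4 * y ^ 2 < 4 * m ^ 2 * r ^ 2)
    (h2 : m ^ 2 * (1 + 4 * y ^ 2) < (m ^ 2 * r + y ^ 2) ^ 2) : highRoot r T k < 2 * m / T := by
  have hκ := ratio_pos hT k
  have hsq := sq_le_ratio T k
  set ρ := ratio T k / T with hρ
  have hρ0 : 0 < ρ := by positivity
  have hκρ : ratio T k = ρ * T := by rw [hρ]; field_simp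
  have hk : (k * T) ^ 2 = 4 * y ^ 2 := by rw [hy]; ring
  have hρ2 : 1 ≤ ρ ^ 2 * (1 + 4 * y ^ 2) := by
    rw [hk, hκρ] at hsq
    have : T ^ 2 * 1 ≤ T ^ 2 * (ρ ^ 2 * (1 + 4 * y ^ 2)) := by linarith
    exact le_of_mul_le_mul_left this (by positivity)
  have a1 : 1 < 2 * m * r * ρ := by
    have : 1 ^ 2 < (2 * m * r * ρ) ^ 2 := by
      have := mul_lt_mul_of_pos_left h1 (pow_pos hρ0 2)
      nlinarith
    exact lt_of_pow_lt_pow_left₀ 2 (by positivity) this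
  have a2 : m < ρ * (m ^ 2 * r + y ^ 2) := by
    have : m ^ 2 < (ρ * (m ^ 2 * r + y ^ 2)) ^ 2 := by
      have h3 := mul_lt_mul_of_pos_left h2 (pow_pos hρ0 2)
      have h4 := mul_le_mul_of_nonneg_left hρ2 (sq_nonneg m)
      nlinarith
    exact lt_of_pow_lt_pow_left₀ 2 (by positivity) this
  refine highRoot_lt hr hr1 hT ?_ ?_
  · rw [hκρ]
    convert! a1 using 1
    field_simp
  · rw [hκρ]
    have e : r * (ρ * T) * (2 * m / T) ^ 2 - 2 * (2 * m / T) + k ^ 2 * (ρ * T) =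
        4 / T * (ρ * (m ^ 2 * r + y ^ 2) - m) := by
      rw [hy]
      field_simp
      ring
    rw [e]
    exact mul_pos (by positivity) (by linarith)

/-- Already m⁴r² exceeds the left side, so the second condition for high roots follows from a
sharper form of the first. -/
theorem add_sq_gt {r m q : ℝ} (hm : 0 < m) (hr : 0 < r) (hq : 0 ≤ q)
    (h : 1 + 4 * q < (m * r) ^ 2) : m ^ 2 * (1 + 4 * q) < (m ^ 2 * r + q) ^ 2 := by
  have h4 := mul_lt_mul_of_pos_left h (pow_pos hm 2)
  have h5 : 0 ≤ 2 * (m ^ 2 * r) * q := by positivity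
  have h6 := sq_nonneg q
  linarith

/-- With x = m - 1 ≤ 1/5, the bounds give 4y² ≤ 1.152 x and (mr)² ≥ 1 + 1.52 x. -/
theorem poly_of_le {r m y : ℝ} (hm : 1 < m) (hm2 : m ≤ 6 / 5) (hr : 0 < r)
    (hδ : 1 - r ≤ (m - 1) / 5) (hy : 0 ≤ y)
    (hy1 : y ≤ 6 / 5 * (m - 1)) : 1 + 4 * y ^ 2 < 4 * m ^ 2 * r ^ 2 ∧
        m ^ 2 * (1 + 4 * y ^ 2) < (m ^ 2 * r + y ^ 2) ^ 2 := by
  have hq : y ^ 2 ≤ 288 / 1000 * (m - 1) := by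
    have : y ^ 2 ≤ (6 / 5 * (m - 1)) ^ 2 := by gcongr
    nlinarith
  have h1 : 1 + 19 / 25 * (m - 1) ≤ m * r := by
    have : m * (1 - (m - 1) / 5) ≤ m * r := by gcongr; linarith
    nlinarith
  have h2 : (1 + 19 / 25 * (m - 1)) ^ 2 ≤ (m * r) ^ 2 := by
    have : 0 ≤ 1 + 19 / 25 * (m - 1) := by linarith
    gcongr
  have h3 : 1 + 4 * y ^ 2 < (m * r) ^ 2 := by nlinarith
  refine ⟨?_, add_sq_gt (by linarith) hr (sq_nonneg y) h3⟩
  have := sq_nonneg (m * r)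
  linarith

/-- The left side is at most 1 + 4m²/25 and (mr)² is at least (24/25)²m², which is larger once m ≥
6/5. -/
theorem poly_of_ge {r m y : ℝ} (hm : 6 / 5 ≤ m) (hr : 0 < r)
    (hr2 : (24 / 25 : ℝ) ^ 2 ≤ r ^ 2) (hy : 0 ≤ y)
    (hy1 : y ≤ m / 5) : 1 + 4 * y ^ 2 < 4 * m ^ 2 * r ^ 2 ∧
        m ^ 2 * (1 + 4 * y ^ 2) < (m ^ 2 * r + y ^ 2) ^ 2 := by
  have hq : y ^ 2 ≤ (m / 5) ^ 2 := by gcongr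
  have hmm : (6 / 5) ^ 2 ≤ m ^ 2 := by gcongr
  have h2 := mul_le_mul_of_nonneg_left hr2 (sq_nonneg m)
  have h3 : 1 + 4 * y ^ 2 < (m * r) ^ 2 := by linarith
  refine ⟨?_, add_sq_gt (by linarith) hr (sq_nonneg y) h3⟩
  have := sq_nonneg (m * r)
  linarith

/-- The frequencies are split at a threshold y₁: high roots with |k|T/2 ≤ y₁ are small by
near-balance, and low roots are small when |k|T/2 < sm - y₁. Since nT/2 = sm, the two ranges satisfy
j + l + 1 = n. -/
theorem exists_split (hs : 1 < s) (hs2 : s ≤ 6 / 5) (hst : Real.tanh s = 1 / s)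
    {n : ℕ} (hn : 1 ≤ n) {r T : ℝ} (hr1 : r ≤ 1) (hT : 2 * s / n < T)
    (h : n / s ≤ lowRoot r T n) : ∃ j l : ℕ, j + l + 1 = n ∧
      (∀ k : ℤ, |k| ≤ l → lowRoot r T k < n / s) ∧
      (∀ k : ℤ, |k| ≤ j → highRoot r T k < n / s) := by
  have hs0 : 0 < s := by linarith
  have hn0 : (0 : ℝ) < n := by exact_mod_cast hn
  have hTpos : 0 < T := lt_trans (by positivity) hT
  obtain ⟨m, hTm⟩ : ∃ m, T = 2 * s * m / n := ⟨n * T / (2 * s), by field_simp⟩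
  have hm : 1 < m := by
    rw [hTm, div_lt_div_iff_of_pos_right hn0] at hT
    by_contra! hc
    nlinarith
  have hm0 : 0 < m := by linarith
  obtain ⟨hδ1, hδ2⟩ := one_sub_le_of_le_lowRoot hs hs2 hst hn hm hTm h
  have hr : 0 < r := by linarith
  have hns : (n : ℝ) / s = 2 * m / T := by rw [hTm]; field_simp
  have hx : n * T / 2 = s * m := by rw [hTm]; field_simp
  have main : ∀ y₁ : ℝ, 0 ≤ y₁ → y₁ < s * m →
      (∀ y, 0 ≤ y → y ≤ y₁ → 1 + 4 * y ^ 2 < 4 * m ^ 2 * r ^ 2 ∧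
        m ^ 2 * (1 + 4 * y ^ 2) < (m ^ 2 * r + y ^ 2) ^ 2) →
      (∀ k : ℝ, 0 ≤ k → k < n → k * T / 2 < s * m - y₁ → k * Real.tanh (k * T / 2) < n / s) →
      ∃ j l : ℕ, j + l + 1 = n ∧
        (∀ k : ℤ, |k| ≤ l → lowRoot r T k < n / s) ∧
        (∀ k : ℤ, |k| ≤ j → highRoot r T k < n / s) := by
    intro y₁ hy0 hy1 hhigh hlow
    -- The floor keeps jT/2 ≤ y₁, while (j + 1)T/2 > y₁ gives lT/2 < sm - y₁ for l = n - 1 - j.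
    set j := ⌊2 * y₁ / T⌋₊ with hj
    have hj1 : (j : ℝ) ≤ 2 * y₁ / T := Nat.floor_le (by positivity)
    have hj2 : 2 * y₁ / T < j + 1 := Nat.lt_floor_add_one _
    rw [le_div_iff₀ hTpos] at hj1
    rw [div_lt_iff₀ hTpos] at hj2
    have hjn : j < n := by
      have : (j : ℝ) * T < n * T := by linarith
      exact_mod_cast lt_of_mul_lt_mul_right this hTpos.le
    obtain ⟨l, hl⟩ : ∃ l, j + l + 1 = n := ⟨n - 1 - j, by lia⟩
    have hlR : (j : ℝ) + l + 1 = n := by exact_mod_cast hl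
    refine ⟨j, l, hl, fun k hk => ?_, fun k hk => ?_⟩
    · have hkR : |(k : ℝ)| ≤ l := by exact_mod_cast hk
      refine (lowRoot_le hr1 hTpos _).trans_lt (hlow _ (abs_nonneg _) ?_ ?_)
      · have : (0 : ℝ) ≤ j := by positivity
        linarith
      · have := mul_le_mul_of_nonneg_right hkR hTpos.le
        rw [← hlR] at hx
        linarith
    · have hkR : |(k : ℝ)| ≤ j := by exact_mod_cast hk
      rw [hns]
      have h3 : |(k : ℝ)| * T / 2 ≤ y₁ := by
        have := mul_le_mul_of_nonneg_right hkR hTpos.le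
        linarith
      obtain ⟨p1, p2⟩ := hhigh (|(k : ℝ)| * T / 2) (by positivity) h3
      exact highRoot_lt_of_poly hr hr1 hTpos hm0
        (by rw [div_pow, div_pow, mul_pow, mul_pow, sq_abs]) p1 p2
  have hr2 : (24 / 25 : ℝ) ^ 2 ≤ r ^ 2 := by
    have : (24 / 25 : ℝ) ≤ r := by linarith
    gcongr
  rcases le_or_gt m (6 / 5) with hcase | hcase
  -- This threshold leaves low modes with kT/2 < s, where tanh < 1/s and k < n suffice.
  · refine main (s * (m - 1)) (mul_nonneg hs0.le (by linarith)) (by nlinarith) ?_ ?_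
    · intro y hy hy1
      exact poly_of_le hm hcase (by linarith) hδ1 hy (hy1.trans (by nlinarith))
    · intro k hk0 hkn hk
      have hz : k * T / 2 < s := by linarith
      have ht : Real.tanh (k * T / 2) < 1 / s := by rw [← hst]; exact tanh_strictMono hz
      calc k * Real.tanh (k * T / 2) ≤ k * (1 / s) := by gcongr
        _ < n * (1 / s) := by gcongr
        _ = n / s := by ring
  -- This threshold leaves low modes with kT/2 < m, that is k < n/s, where tanh < 1 suffices. It is
  -- at most m/5 since s ≤ 6/5.
  · refine main ((s - 1) * m) (mul_nonneg (by linarith) hm0.le) (by nlinarith) ?_ ?_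
    · intro y hy hy1
      exact poly_of_ge hcase.le (by linarith) hr2 hy (hy1.trans (by nlinarith))
    · intro k hk0 hkn hk
      have h1 : k < n / s := by
        rw [hns, lt_div_iff₀ hTpos]
        linarith
      have := Real.tanh_lt_one (k * T / 2)
      nlinarith

/-! ### Counting roots: the bound and its equality case -/

variable {T : ℝ} {f : ℝ → ℝ}

theorem ncard_image_Icc (b : Bool) (l : ℕ) :
    ((fun k : ℤ => (k, b)) '' Icc (-l : ℤ) l).ncard = 2 * l + 1 := by
  rw [Set.ncard_image_of_injective _ (fun x y h => congrArg Prod.fst h), ← Finset.coe_Icc,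
    Set.ncard_coe_finset, Int.card_Icc]
  lia

theorem ncard_image_union (j l : ℕ) :
    ((fun k : ℤ => (k, false)) '' Icc (-l : ℤ) l ∪
      (fun k : ℤ => (k, true)) '' Icc (-j : ℤ) j).ncard = 2 * l + 1 + (2 * j + 1) := by
  rw [Set.ncard_union_eq ?_ ((Set.finite_Icc _ _).image _) ((Set.finite_Icc _ _).image _),
    ncard_image_Icc, ncard_image_Icc]
  rw [Set.disjoint_left]
  rintro _ ⟨k, _, rfl⟩ ⟨l, _, h⟩
  exact Bool.noConfusion (congrArg Prod.snd h)

/-- The low roots with |k| ≤ n supply 2n + 1 indices, more than the 2n needed. -/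
theorem eigenvalue_le_lowRoot (hT : 0 < T) (hf : IsConformalFactor T f) {n : ℕ} (hn : 1 ≤ n) :
    eigenvalue T f (2 * n - 1) ≤
      2 / (f 0 + f T) * lowRoot (balance (f 0) (f T)) T n := by
  have ha := hf.pos_left hT
  have hb := hf.pos_right hT
  refine (eigenvalue_spec hT hf (2 * n - 1)).1.2 ?_
  have hsub : (fun k : ℤ => (k, false)) '' Icc (-n : ℤ) n ⊆ {i | steklovValue T f i ≤
      2 / (f 0 + f T) * lowRoot (balance (f 0) (f T)) T n} := by
    rintro _ ⟨k, hk, rfl⟩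
    have hkR : |(k : ℝ)| ≤ |(n : ℝ)| := by
      rw [abs_of_nonneg (by positivity : (0 : ℝ) ≤ n)]
      exact_mod_cast abs_le.2 hk
    exact mul_le_mul_of_nonneg_left (lowRoot_mono (balance_pos ha hb) hT hkR) (by positivity)
  have := Set.ncard_le_ncard hsub (finite_steklovValue_le hT hf _)
  rw [ncard_image_Icc] at this
  change 2 * n - 1 < _
  lia

/-- Assuming the reverse inequality yields the upper bound and the rigidity at once. -/
theorem eigenvalue_le_and_eq (hs : 1 < s) (hs2 : s ≤ 6 / 5) (hst : Real.tanh s = 1 / s)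
    {n : ℕ} (hn : 1 ≤ n) (hT : 0 < T) (hf : IsConformalFactor T f)
    (h : 2 / (f 0 + f T) * (n / s) ≤ eigenvalue T f (2 * n - 1)) :
    eigenvalue T f (2 * n - 1) = 2 / (f 0 + f T) * (n / s) ∧ T = 2 * s / n ∧ f 0 = f T := by
  have ha := hf.pos_left hT
  have hb := hf.pos_right hT
  have hs0 : 0 < s := by linarith
  have hn0 : (0 : ℝ) < n := by exact_mod_cast hn
  have hr := balance_pos ha hb
  have hr1 := balance_le_one ha hb
  have hpos : 0 < 2 / (f 0 + f T) := by positivity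
  have hle := eigenvalue_le_lowRoot hT hf hn
  have hlow : n / s ≤ lowRoot (balance (f 0) (f T)) T n :=
    le_of_mul_le_mul_left (h.trans hle) hpos
  rcases lt_or_ge (2 * s / n) T with hTs | hTs
  · exfalso
    obtain ⟨j, l, hjl, hl, hj⟩ := exists_split hs hs2 hst hn hr1 hTs hlow
    have hsub : (fun k : ℤ => (k, false)) '' Icc (-l : ℤ) l ∪
        (fun k : ℤ => (k, true)) '' Icc (-j : ℤ) j ⊆
        {i | steklovValue T f i < eigenvalue T f (2 * n - 1)} := by
      rintro _ (⟨k, hk, rfl⟩ | ⟨k, hk, rfl⟩)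
      · exact (mul_lt_mul_of_pos_left (hl k (abs_le.2 hk)) hpos).trans_le h
      · exact (mul_lt_mul_of_pos_left (hj k (abs_le.2 hk)) hpos).trans_le h
    -- The split exhibits 2n indices strictly below the eigenvalue, where only 2n - 1 are allowed.
    have h1 := Set.ncard_le_ncard hsub ((finite_steklovValue_le hT hf
      (eigenvalue T f (2 * n - 1))).subset fun i hi => le_of_lt (show steklovValue T f i < _ from hi))
    rw [ncard_image_union] at h1
    have h2 := (eigenvalue_spec hT hf (2 * n - 1)).2
    lia
  · have hx : |(n : ℝ)| * T / 2 ≤ s := by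
      rw [abs_of_pos hn0]
      rw [le_div_iff₀ hn0] at hTs
      linarith
    have ht : Real.tanh (|(n : ℝ)| * T / 2) ≤ 1 / s := by
      rw [← hst]; exact tanh_strictMono.monotone hx
    have hns : (n : ℝ) * (1 / s) = n / s := by ring
    have hT' : T = 2 * s / n := by
      by_contra hne
      have hlt : |(n : ℝ)| * T / 2 < s := by
        refine lt_of_le_of_ne hx fun he => hne ?_
        rw [abs_of_pos hn0] at he
        rw [eq_div_iff hn0.ne']
        linarith
      have ht' : Real.tanh (|(n : ℝ)| * T / 2) < 1 / s := by
        rw [← hst]; exact tanh_strictMono hlt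
      have h1 := hlow.trans (lowRoot_le hr1 hT n)
      rw [abs_of_pos hn0] at h1 ht'
      have := mul_lt_mul_of_pos_left ht' hn0
      linarith
    have hbal : f 0 = f T := by
      rw [← balance_eq_one_iff ha hb]
      by_contra hne
      have h1 := hlow.trans_lt (lowRoot_lt hT hn0.ne' (lt_of_le_of_ne hr1 hne))
      rw [abs_of_pos hn0] at h1 ht
      have := mul_le_mul_of_nonneg_left ht hn0.le
      linarith
    refine ⟨le_antisymm (hle.trans ?_) h, hT', hbal⟩
    have h1 := lowRoot_le hr1 hT n
    rw [abs_of_pos hn0] at h1 ht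
    have := mul_le_mul_of_nonneg_left ht hn0.le
    exact mul_le_mul_of_nonneg_left (by linarith) hpos.le

theorem normalizedEigenvalue_eq (k : ℕ) (ha : 0 < f 0) (hb : 0 < f T) (ν : ℝ) :
    normalizedEigenvalue T f k = 4 * π * ν ↔ eigenvalue T f k = 2 / (f 0 + f T) * ν := by
  have hπ := Real.pi_pos
  unfold normalizedEigenvalue boundaryLength
  have : eigenvalue T f k * (2 * π * f 0 + 2 * π * f T) =
      (2 * π) * (eigenvalue T f k * (f 0 + f T)) := by ring
  rw [this, div_mul_eq_mul_div, eq_div_iff (by positivity)]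
  constructor
  · intro h
    have : (2 * π) * (eigenvalue T f k * (f 0 + f T)) = (2 * π) * (2 * ν) := by linarith
    exact mul_left_cancel₀ (by positivity) this
  · intro h
    rw [h]; ring

theorem normalizedEigenvalue_le (hs : 1 < s) (hs2 : s ≤ 6 / 5) (hst : Real.tanh s = 1 / s)
    {n : ℕ} (hn : 1 ≤ n) (hT : 0 < T) (hf : IsConformalFactor T f) :
    normalizedEigenvalue T f (2 * n - 1) ≤ 4 * π * n / s := by
  have ha := hf.pos_left hT
  have hb := hf.pos_right hT
  have hle : eigenvalue T f (2 * n - 1) ≤ 2 / (f 0 + f T) * (n / s) := by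
    by_contra! hc
    exact absurd (eigenvalue_le_and_eq hs hs2 hst hn hT hf hc.le).1 hc.ne'
  have hπ := Real.pi_pos
  have hL : 0 < boundaryLength T f := by unfold boundaryLength; positivity
  calc normalizedEigenvalue T f (2 * n - 1) ≤ 2 / (f 0 + f T) * (n / s) * boundaryLength T f :=
        mul_le_mul_of_nonneg_right hle hL.le
    _ = 4 * π * n / s := by unfold boundaryLength; field_simp; ring

/-! ### The critical cylinder -/

section critical

variable {n : ℕ}

theorem lowRoot_critical_lt (hs : 1 < s) (hst : Real.tanh s = 1 / s) (hn : 1 ≤ n) {k : ℤ}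
    (hk : |k| < n) : lowRoot 1 (2 * s / n) k < n / s := by
  have hn0 : (0 : ℝ) < n := by exact_mod_cast hn
  have hkR : |(k : ℝ)| < n := by exact_mod_cast hk
  rw [lowRoot_one (by positivity)]
  have hle : |(k : ℝ)| * (2 * s / n) / 2 ≤ s := by
    have : |(k : ℝ)| * (2 * s / n) / 2 = |(k : ℝ)| / n * s := by field_simp
    rw [this]
    have : |(k : ℝ)| / n ≤ 1 := by rw [div_le_one hn0]; exact hkR.le
    nlinarith
  calc |(k : ℝ)| * Real.tanh (|(k : ℝ)| * (2 * s / n) / 2) ≤ |(k : ℝ)| * Real.tanh s := by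
        gcongr; exact tanh_strictMono.monotone hle
    _ < n * Real.tanh s := by
        have := tanh_pos (show 0 < s by linarith)
        gcongr
    _ = n / s := by rw [hst]; ring

theorem lowRoot_critical_eq (hs : 1 < s) (hst : Real.tanh s = 1 / s) (hn : 1 ≤ n) {k : ℤ}
    (hk : |k| = n) : lowRoot 1 (2 * s / n) k = n / s := by
  have hn0 : (0 : ℝ) < n := by exact_mod_cast hn
  have hkR : |(k : ℝ)| = n := by exact_mod_cast hk
  rw [lowRoot_one (by positivity), hkR]
  have : (n : ℝ) * (2 * s / n) / 2 = s := by field_simp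
  rw [this, hst]; ring

theorem lt_lowRoot_critical (hs : 1 < s) (hst : Real.tanh s = 1 / s) (hn : 1 ≤ n) {k : ℤ}
    (hk : n < |k|) : n / s < lowRoot 1 (2 * s / n) k := by
  have hn0 : (0 : ℝ) < n := by exact_mod_cast hn
  have hkR : n < |(k : ℝ)| := by exact_mod_cast hk
  rw [lowRoot_one (by positivity)]
  have hle : s ≤ |(k : ℝ)| * (2 * s / n) / 2 := by
    have : |(k : ℝ)| * (2 * s / n) / 2 = |(k : ℝ)| / n * s := by field_simp
    rw [this]
    have : 1 ≤ |(k : ℝ)| / n := by rw [one_le_div hn0]; exact hkR.le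
    nlinarith
  calc n / s = n * Real.tanh s := by rw [hst]; ring
    _ < |(k : ℝ)| * Real.tanh s := by
        have := tanh_pos (show 0 < s by linarith)
        gcongr
    _ ≤ |(k : ℝ)| * Real.tanh (|(k : ℝ)| * (2 * s / n) / 2) := by
        gcongr; exact tanh_strictMono.monotone hle

theorem highRoot_critical_zero (hs : 1 < s) (hn : 1 ≤ n) :
    highRoot 1 (2 * s / n) 0 = n / s := by
  have hn0 : (0 : ℝ) < n := by exact_mod_cast hn
  rw [highRoot_one_zero]; field_simp

theorem lt_highRoot_critical (hs : 1 < s) (hn : 1 ≤ n) {k : ℤ} (hk : k ≠ 0) :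
    n / s < highRoot 1 (2 * s / n) k := by
  have hn0 : (0 : ℝ) < n := by exact_mod_cast hn
  have h := lt_highRoot_one (T := 2 * s / n) (k := k) (by positivity) (by exact_mod_cast hk)
  have e : 2 / (2 * s / n) = n / s := by field_simp
  rwa [e] at h

/-- Exactly 2n - 1 indices lie below n/s, so the root numbered 2n - 1, counted from 0, is at least
n/s. -/
theorem normalizedRoot_critical_lt_iff (hs : 1 < s) (hst : Real.tanh s = 1 / s) (hn : 1 ≤ n)
    (i : ℤ × Bool) : normalizedRoot 1 (2 * s / n) i < n / s ↔ |i.1| < n ∧ i.2 = false := by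
  obtain ⟨k, b⟩ := i
  cases b
  · simp only [normalizedRoot, Bool.false_eq_true, if_false, and_true]
    refine ⟨fun h => ?_, lowRoot_critical_lt hs hst hn⟩
    by_contra! hc
    rcases hc.eq_or_lt with hc | hc
    · exact absurd (lowRoot_critical_eq hs hst hn hc.symm) h.ne
    · exact absurd (lt_lowRoot_critical hs hst hn hc) h.le.not_gt
  · simp only [normalizedRoot, if_true, Bool.true_eq_false, and_false, iff_false, not_lt]
    by_cases hk : k = 0
    · subst hk
      simp [highRoot_critical_zero hs hn]
    · exact (lt_highRoot_critical hs hn hk).le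

/-- The critical length makes the high root 2/T of mode 0 coincide with the low roots of modes ±n,
which creates multiplicity three. -/
theorem normalizedRoot_critical_eq_iff (hs : 1 < s) (hst : Real.tanh s = 1 / s) (hn : 1 ≤ n)
    (i : ℤ × Bool) : normalizedRoot 1 (2 * s / n) i = n / s ↔
      i = (0, true) ∨ i = ((n : ℤ), false) ∨ i = (-(n : ℤ), false) := by
  obtain ⟨k, b⟩ := i
  cases b
  · simp only [normalizedRoot, Bool.false_eq_true, if_false, Prod.mk.injEq, and_true, and_false,
      false_or]
    have habs : k = n ∨ k = -n ↔ |k| = n := by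
      rw [abs_eq (by positivity)]
    rw [habs]
    refine ⟨fun h => ?_, lowRoot_critical_eq hs hst hn⟩
    rcases lt_trichotomy |k| (n : ℤ) with hc | hc | hc
    · exact absurd h (lowRoot_critical_lt hs hst hn hc).ne
    · exact hc
    · exact absurd h (lt_lowRoot_critical hs hst hn hc).ne'
  · simp only [normalizedRoot, if_true, Prod.mk.injEq, and_true, Bool.true_eq_false, and_false,
      or_false]
    refine ⟨fun h => ?_, ?_⟩
    · by_contra hk
      exact absurd h (lt_highRoot_critical hs hn hk).ne'
    · rintro rfl
      simpa using highRoot_critical_zero hs hn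

theorem eigenvalue_critical (hs : 1 < s) (hs2 : s ≤ 6 / 5) (hst : Real.tanh s = 1 / s)
    (hn : 1 ≤ n) (hf : IsConformalFactor (2 * s / n) f) (hb : f 0 = f (2 * s / n)) :
    eigenvalue (2 * s / n) f (2 * n - 1) = 2 / (f 0 + f (2 * s / n)) * (n / s) := by
  have hn0 : (0 : ℝ) < n := by exact_mod_cast hn
  have hT : 0 < 2 * s / n := by positivity
  have ha := hf.pos_left hT
  have hb' := hf.pos_right hT
  -- Only the lower bound remains: a smaller eigenvalue would have at most 2n - 1 indices below or
  -- at it.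
  refine (eigenvalue_le_and_eq hs hs2 hst hn hT hf ?_).1
  by_contra! hc
  have h1 := (eigenvalue_spec hT hf (2 * n - 1)).1.1
  have hsub : {i | steklovValue (2 * s / n) f i ≤ eigenvalue (2 * s / n) f (2 * n - 1)} ⊆
      (fun k : ℤ => (k, false)) '' Icc (-(n - 1 : ℕ) : ℤ) (n - 1 : ℕ) := by
    intro i hi
    have h2 := lt_of_le_of_lt (show steklovValue (2 * s / n) f i ≤ _ from hi) hc
    rw [steklovValue, (balance_eq_one_iff ha hb').2 hb] at h2
    have h3 := lt_of_mul_lt_mul_left h2 (by positivity)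
    rw [normalizedRoot_critical_lt_iff hs hst hn] at h3
    refine ⟨i.1, abs_le.1 ?_, Prod.ext rfl h3.2.symm⟩
    have := h3.1
    lia
  have h2 := Set.ncard_le_ncard hsub ((Set.finite_Icc _ _).image _)
  rw [ncard_image_Icc] at h2
  change 2 * n - 1 < _ at h1
  lia

theorem steklovValue_critical_iff (hs : 1 < s) (hs2 : s ≤ 6 / 5) (hst : Real.tanh s = 1 / s)
    (hn : 1 ≤ n) (hf : IsConformalFactor (2 * s / n) f) (hb : f 0 = f (2 * s / n)) (i : ℤ × Bool) :
    steklovValue (2 * s / n) f i = eigenvalue (2 * s / n) f (2 * n - 1) ↔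
      i = (0, true) ∨ i = ((n : ℤ), false) ∨ i = (-(n : ℤ), false) := by
  have hn0 : (0 : ℝ) < n := by exact_mod_cast hn
  have hT : 0 < 2 * s / n := by positivity
  have ha := hf.pos_left hT
  have hb' := hf.pos_right hT
  rw [eigenvalue_critical hs hs2 hst hn hf hb, steklovValue, (balance_eq_one_iff ha hb').2 hb,
    mul_right_inj' (by positivity), normalizedRoot_critical_eq_iff hs hst hn]

end critical

end bound

/-! ### The critical `n`-catenoid -/

theorem hasDerivAt_vec3 {a b c : ℝ → ℝ} {a' b' c' x : ℝ} (ha : HasDerivAt a a' x)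
    (hb : HasDerivAt b b' x) (hc : HasDerivAt c c' x) :
    HasDerivAt (fun x => (!₂[a x, b x, c x] : EuclideanSpace ℝ (Fin 3))) !₂[a', b', c'] x := by
  have h : HasDerivAt (fun x => ![a x, b x, c x]) ![a', b', c'] x := by
    rw [hasDerivAt_pi]
    intro i
    fin_cases i
    · exact ha
    · exact hb
    · exact hc
  exact (PiLp.continuousLinearEquiv 2 ℝ (fun _ : Fin 3 => ℝ)).symm.hasFDerivAt.comp_hasDerivAt x h

theorem inner_vec3 (a b c a' b' c' : ℝ) :
    ⟪(!₂[a, b, c] : EuclideanSpace ℝ (Fin 3)), !₂[a', b', c']⟫_ℝ = a * a' + b * b' + c * c' := by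
  simp [PiLp.inner_apply, Fin.sum_univ_three]
  ring

theorem norm_vec3 (a b c : ℝ) :
    ‖(!₂[a, b, c] : EuclideanSpace ℝ (Fin 3))‖ = √(a ^ 2 + b ^ 2 + c ^ 2) := by
  simp [EuclideanSpace.norm_eq, Fin.sum_univ_three]

section catenoid

variable {n : ℕ} {s : ℝ}

theorem nCatenoidPiece_apply (hn : 1 ≤ n) (t : Icc (0 : ℝ) (2 * s / n)) (θ : ℝ) :
    nCatenoidPiece n s (t, (θ : Real.Angle)) = !₂[n * (t : ℝ) - s,
      Real.cosh (n * t - s) * Real.cos (n * θ), Real.cosh (n * t - s) * Real.sin (n * θ)] := by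
  have hn0 : (n : ℝ) ≠ 0 := by positivity
  have h1 : (n : ℝ) * (t - s / n) = n * t - s := by field_simp
  have h2 : n • (θ : Real.Angle) = ((n * θ : ℝ) : Real.Angle) := by
    rw [← nsmul_eq_mul, Real.Angle.coe_nsmul]
  simp only [nCatenoidPiece, nCatenoid, catenoid, h1, h2, Real.Angle.cos_coe, Real.Angle.sin_coe]

theorem coord_nCatenoidPiece (hn : 1 ≤ n) {t : ℝ} (ht : t ∈ Icc (0 : ℝ) (2 * s / n)) (θ : ℝ) :
    coord (nCatenoidPiece n s) t θ = !₂[n * t - s,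
      Real.cosh (n * t - s) * Real.cos (n * θ), Real.cosh (n * t - s) * Real.sin (n * θ)] := by
  rw [coord_of_mem _ ht, nCatenoidPiece_apply hn]

theorem hasDerivAt_affine (n t s : ℝ) : HasDerivAt (fun t => n * t - s) n t := by
  simpa using ((hasDerivAt_id t).const_mul n).sub_const s

theorem hasDerivAt_const_mul_self (n t : ℝ) : HasDerivAt (fun t => n * t) n t := by
  simpa using (hasDerivAt_id t).const_mul n

theorem partialT_nCatenoidPiece (hs : 0 < s) (hn : 1 ≤ n) {t : ℝ}
    (ht : t ∈ Icc (0 : ℝ) (2 * s / n)) (θ : ℝ) :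
    partialT (2 * s / n) (coord (nCatenoidPiece n s)) t θ = !₂[(n : ℝ),
      n * Real.sinh (n * t - s) * Real.cos (n * θ),
      n * Real.sinh (n * t - s) * Real.sin (n * θ)] := by
  have hn0 : (0 : ℝ) < n := by exact_mod_cast hn
  refine partialT_eq (by positivity) ht (fun t ht => coord_nCatenoidPiece hn ht θ) ?_
  have hl := hasDerivAt_affine n t s
  refine hasDerivAt_vec3 hl ?_ ?_
  · rw [mul_comm (n : ℝ) (Real.sinh _)]; exact hl.cosh.mul_const _
  · rw [mul_comm (n : ℝ) (Real.sinh _)]; exact hl.cosh.mul_const _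

theorem partialT_partialT_nCatenoidPiece (hs : 0 < s) (hn : 1 ≤ n) {t : ℝ}
    (ht : t ∈ Icc (0 : ℝ) (2 * s / n)) (θ : ℝ) :
    partialT (2 * s / n) (partialT (2 * s / n) (coord (nCatenoidPiece n s))) t θ = !₂[(0 : ℝ),
      n ^ 2 * Real.cosh (n * t - s) * Real.cos (n * θ),
      n ^ 2 * Real.cosh (n * t - s) * Real.sin (n * θ)] := by
  have hn0 : (0 : ℝ) < n := by exact_mod_cast hn
  refine partialT_eq (by positivity) ht (fun t ht => partialT_nCatenoidPiece hs hn ht θ) ?_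
  have hl := hasDerivAt_affine n t s
  have e : (n : ℝ) ^ 2 * Real.cosh (n * t - s) = n * (Real.cosh (n * t - s) * n) := by ring
  refine hasDerivAt_vec3 (hasDerivAt_const _ _) ?_ ?_
  · rw [e]; exact (hl.sinh.const_mul _).mul_const _
  · rw [e]; exact (hl.sinh.const_mul _).mul_const _

theorem partialθ_nCatenoidPiece (hn : 1 ≤ n) {t : ℝ}
    (ht : t ∈ Icc (0 : ℝ) (2 * s / n)) (θ : ℝ) :
    partialθ (coord (nCatenoidPiece n s)) t θ = !₂[(0 : ℝ),
      Real.cosh (n * t - s) * (-Real.sin (n * θ) * n),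
      Real.cosh (n * t - s) * (Real.cos (n * θ) * n)] := by
  refine partialθ_eq (fun θ => coord_nCatenoidPiece hn ht θ) ?_
  have hl := hasDerivAt_const_mul_self n θ
  exact hasDerivAt_vec3 (hasDerivAt_const _ _) (hl.cos.const_mul _) (hl.sin.const_mul _)

theorem partialθ_partialθ_nCatenoidPiece (hn : 1 ≤ n) {t : ℝ}
    (ht : t ∈ Icc (0 : ℝ) (2 * s / n)) (θ : ℝ) :
    partialθ (partialθ (coord (nCatenoidPiece n s))) t θ = !₂[(0 : ℝ),
      Real.cosh (n * t - s) * (-(Real.cos (n * θ) * n) * n),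
      Real.cosh (n * t - s) * (-Real.sin (n * θ) * n * n)] := by
  refine partialθ_eq (fun θ => partialθ_nCatenoidPiece hn ht θ) ?_
  have hl := hasDerivAt_const_mul_self n θ
  exact hasDerivAt_vec3 (hasDerivAt_const _ _) ((hl.sin.neg.mul_const _).const_mul _)
    ((hl.cos.mul_const _).const_mul _)

/-- The conformal factor of the metric induced by the critical `n`-catenoid. -/
def catenoidFactor (n : ℕ) (s t : ℝ) : ℝ := n * Real.cosh (n * t - s)

theorem isConformalFactor_catenoidFactor (hn : 1 ≤ n) :
    IsConformalFactor (2 * s / n) (catenoidFactor n s) := by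
  have hn0 : (0 : ℝ) < n := by exact_mod_cast hn
  refine ⟨?_, fun t _ => mul_pos hn0 (Real.cosh_pos _)⟩
  have : ContDiff ℝ ∞ (catenoidFactor n s) := by unfold catenoidFactor; fun_prop
  exact this.contDiffOn

theorem catenoidFactor_symm (hn : 1 ≤ n) :
    catenoidFactor n s 0 = catenoidFactor n s (2 * s / n) := by
  have hn0 : (0 : ℝ) < n := by exact_mod_cast hn
  have h1 : (n : ℝ) * (2 * s / n) - s = s := by field_simp; ring
  rw [catenoidFactor, catenoidFactor, h1, mul_zero, zero_sub, Real.cosh_neg]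

theorem isInducedMetric_catenoidFactor (hs : 0 < s) (hn : 1 ≤ n) :
    IsInducedMetric (catenoidFactor n s) (nCatenoidPiece n s) := by
  intro t ht θ
  rw [partialT_nCatenoidPiece hs hn ht, partialθ_nCatenoidPiece hn ht, inner_vec3, inner_vec3,
    inner_vec3, catenoidFactor]
  have h1 := Real.sin_sq_add_cos_sq (n * θ)
  have h2 := Real.cosh_sq (n * t - s)
  refine ⟨?_, by ring, ?_⟩
  · linear_combination (n ^ 2 * Real.sinh (n * t - s) ^ 2) * h1 - n ^ 2 * h2
  · linear_combination (n ^ 2 * Real.cosh (n * t - s) ^ 2) * h1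

theorem isSmooth_nCatenoidPiece (hn : 1 ≤ n) : IsSmooth (nCatenoidPiece n s) := by
  have h : ContDiff ℝ ∞ (fun p : ℝ × ℝ => (!₂[n * p.1 - s,
      Real.cosh (n * p.1 - s) * Real.cos (n * p.2),
      Real.cosh (n * p.1 - s) * Real.sin (n * p.2)] : EuclideanSpace ℝ (Fin 3))) := by
    rw [contDiff_euclidean]
    intro i
    fin_cases i <;> simp <;> fun_prop
  exact h.contDiffOn.congr fun p hp => coord_nCatenoidPiece hn hp.1 p.2

theorem norm_coord_nCatenoidPiece (hn : 1 ≤ n) {t : ℝ} (ht : t ∈ Icc (0 : ℝ) (2 * s / n)) (θ : ℝ) :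
    ‖coord (nCatenoidPiece n s) t θ‖ = √((n * t - s) ^ 2 + Real.cosh (n * t - s) ^ 2) := by
  rw [coord_nCatenoidPiece hn ht, norm_vec3]
  congr 1
  have h1 := Real.sin_sq_add_cos_sq (n * θ)
  linear_combination (Real.cosh (n * t - s) ^ 2) * h1

theorem isFreeBoundaryMinimal_nCatenoidPiece (hs : 0 < s) (hsc : s = Real.cosh s / Real.sinh s)
    (hn : 1 ≤ n) :
    IsFreeBoundaryMinimal (√(s ^ 2 + Real.cosh s ^ 2)) (nCatenoidPiece n s) := by
  have hn0 : (0 : ℝ) < n := by exact_mod_cast hn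
  have hT : 0 < 2 * s / n := by positivity
  have hbd : ∀ t ∈ ({0, 2 * s / n} : Set ℝ), t ∈ Icc 0 (2 * s / n) ∧
      (n * t - s = -s ∨ n * t - s = s) := by
    rintro t (rfl | rfl)
    · exact ⟨left_mem_Icc.2 hT.le, Or.inl (by ring)⟩
    · exact ⟨right_mem_Icc.2 hT.le, Or.inr (by field_simp; ring)⟩
  refine ⟨isSmooth_nCatenoidPiece hn, fun t ht θ => ?_, fun t ht θ N _ _ _ => ?_,
    fun t ht θ => ?_, fun t ht θ => ?_, fun t ht θ => ?_⟩
  · rw [partialT_nCatenoidPiece hs hn ht, partialθ_nCatenoidPiece hn ht, LinearIndependent.pair_iff]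
    intro a b hab
    have hc := Real.cosh_pos (n * t - s)
    have h0 := congrArg (fun v : EuclideanSpace ℝ (Fin 3) => v 0) hab
    have h1 := congrArg (fun v : EuclideanSpace ℝ (Fin 3) => v 1) hab
    have h2 := congrArg (fun v : EuclideanSpace ℝ (Fin 3) => v 2) hab
    simp at h0 h1 h2
    have ha : a = 0 := h0.resolve_right (by lia)
    refine ⟨ha, ?_⟩
    subst ha
    have h3 := Real.sin_sq_add_cos_sq (n * θ)
    have h4 : b * (Real.cosh (n * t - s) * n) = 0 := by
      linear_combination (-(b * Real.cosh (n * t - s) * n)) * h3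
        - Real.sin (n * θ) * h1 + Real.cos (n * θ) * h2
    exact (mul_eq_zero.1 h4).resolve_right (by positivity)
  · obtain ⟨hE, hF, hG⟩ := isInducedMetric_catenoidFactor hs hn t ht θ
    -- The immersion is harmonic. Together with conformality (E = G, F = 0) this makes the mean
    -- curvature vanish.
    have hsum : partialT (2 * s / n) (partialT (2 * s / n) (coord (nCatenoidPiece n s))) t θ =
        -partialθ (partialθ (coord (nCatenoidPiece n s))) t θ := by
      rw [partialT_partialT_nCatenoidPiece hs hn ht, partialθ_partialθ_nCatenoidPiece hn ht]
      ext i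
      fin_cases i <;> simp <;> ring
    simp only [meanCurvature]
    rw [hsum, hE, hF, hG, inner_neg_left]
    simp
  · have hm : t ∈ Icc 0 (2 * s / n) := Ioo_subset_Icc_self ht
    rw [norm_coord_nCatenoidPiece hn hm]
    have habs : |n * t - s| < |s| := by
      rw [abs_of_pos hs, abs_lt]
      have h2 := ht.2
      rw [lt_div_iff₀ hn0] at h2
      have := mul_pos hn0 ht.1
      constructor <;> linarith
    refine Real.sqrt_lt_sqrt (by positivity) (add_lt_add (sq_lt_sq.2 habs) ?_)
    exact pow_lt_pow_left₀ (Real.cosh_lt_cosh.2 habs) (Real.cosh_pos _).le two_ne_zero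
  · obtain ⟨hm, h⟩ := hbd t ht
    rw [norm_coord_nCatenoidPiece hn hm]
    rcases h with h | h
    · rw [h, Real.cosh_neg, neg_sq]
    · rw [h]
  · obtain ⟨hm, h⟩ := hbd t ht
    rw [partialT_nCatenoidPiece hs hn hm, coord_nCatenoidPiece hn hm]
    rw [eq_div_iff (Real.sinh_pos_iff.2 hs).ne'] at hsc
    have hcs : Real.cosh (n * t - s) = (n * t - s) * Real.sinh (n * t - s) := by
      rcases h with h | h <;> rw [h]
      · rw [Real.cosh_neg, Real.sinh_neg]; linarith
      · linarith
    -- On the boundary cosh τ = τ sinh τ with τ = nt - s = ±s, so the position vector is τ/n times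
    -- the t-derivative.
    have hmem : ((n * t - s) / n) • (!₂[(n : ℝ), n * Real.sinh (n * t - s) * Real.cos (n * θ),
        n * Real.sinh (n * t - s) * Real.sin (n * θ)] : EuclideanSpace ℝ (Fin 3)) ∈
        Submodule.span ℝ {!₂[(n : ℝ), n * Real.sinh (n * t - s) * Real.cos (n * θ),
        n * Real.sinh (n * t - s) * Real.sin (n * θ)],
        partialθ (coord (nCatenoidPiece n s)) t θ} :=
      Submodule.smul_mem _ _ (Submodule.subset_span (mem_insert _ _))
    convert! hmem using 1
    ext i
    fin_cases i
    · simp; field_simp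
    · simp; rw [hcs]; field_simp
    · simp; rw [hcs]; field_simp

theorem range_nCatenoidPiece (hn : 1 ≤ n) : range (nCatenoidPiece n s) =
    (fun p : ℝ × Real.Angle => catenoid p.1 p.2) '' (Icc (-s) s ×ˢ univ) := by
  have hn0 : (0 : ℝ) < n := by exact_mod_cast hn
  ext x
  constructor
  · rintro ⟨⟨⟨t, ht0, ht1⟩, θ⟩, rfl⟩
    refine ⟨(n * (t - s / n), n • θ), ⟨⟨?_, ?_⟩, mem_univ _⟩, rfl⟩
    · have := mul_nonneg hn0.le ht0
      rw [mul_sub, mul_div_cancel₀ _ hn0.ne']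
      linarith
    · rw [le_div_iff₀ hn0] at ht1
      rw [mul_sub, mul_div_cancel₀ _ hn0.ne']
      linarith
  · rintro ⟨⟨τ, φ⟩, ⟨⟨hτ0, hτ1⟩, -⟩, rfl⟩
    induction φ using Real.Angle.induction_on with
    | _ y =>
      refine ⟨(⟨(τ + s) / n, div_nonneg (by linarith) hn0.le, by gcongr; linarith⟩,
        ((y / n : ℝ) : Real.Angle)), ?_⟩
      have h1 : (n : ℝ) * ((τ + s) / n - s / n) = τ := by field_simp; ring
      have h2 : n • ((y / n : ℝ) : Real.Angle) = y := by
        rw [← Real.Angle.coe_nsmul, nsmul_eq_mul, mul_div_cancel₀ _ hn0.ne']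
      simp only [nCatenoidPiece, nCatenoid, h1, h2]

theorem catenoid_injective {t t' : ℝ} {θ θ' : Real.Angle} (h : catenoid t θ = catenoid t' θ') :
    t = t' ∧ θ = θ' := by
  have h0 := congrArg (fun v : EuclideanSpace ℝ (Fin 3) => v 0) h
  have h1 := congrArg (fun v : EuclideanSpace ℝ (Fin 3) => v 1) h
  have h2 := congrArg (fun v : EuclideanSpace ℝ (Fin 3) => v 2) h
  simp only [catenoid] at h0 h1 h2
  simp at h0 h1 h2
  subst h0
  have hc := (Real.cosh_pos t).ne'
  refine ⟨rfl, ?_⟩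
  induction θ using Real.Angle.induction_on with
  | _ x =>
    induction θ' using Real.Angle.induction_on with
    | _ y =>
      simp only [Real.Angle.cos_coe, Real.Angle.sin_coe] at h1 h2
      exact Real.Angle.cos_sin_inj (mul_left_cancel₀ hc h1) (mul_left_cancel₀ hc h2)

/-- The solutions are the translates of θ by multiples of 2π/n. They are distinct because two
indices below n that differ by a multiple of n are equal. -/
theorem ncard_nsmul_eq (hn : 1 ≤ n) (θ : Real.Angle) :
    {ψ : Real.Angle | n • ψ = n • θ}.ncard = n := by
  have hn0 : (0 : ℝ) < n := by exact_mod_cast hn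
  have hπ := Real.pi_pos
  have hset : {ψ : Real.Angle | n • ψ = n • θ} =
      range (fun k : Fin n => θ + (k : ℕ) • ((2 * π / n : ℝ) : Real.Angle)) := by
    ext ψ
    rw [mem_ofPred_eq, Real.Angle.nsmul_eq_iff (by lia)]
    exact ⟨fun ⟨k, hk⟩ => ⟨k, hk.symm⟩, fun ⟨k, hk⟩ => ⟨k, hk.symm⟩⟩
  have hinj : Function.Injective
      (fun k : Fin n => θ + (k : ℕ) • ((2 * π / n : ℝ) : Real.Angle)) := by
    intro k l hkl
    have h1 := add_left_cancel hkl
    rw [← Real.Angle.coe_nsmul, ← Real.Angle.coe_nsmul, Real.Angle.angle_eq_iff_two_pi_dvd_sub] at h1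
    obtain ⟨m, hm⟩ := h1
    have h2 : ((k : ℕ) : ℝ) - ((l : ℕ) : ℝ) = n * m := by
      simp only [nsmul_eq_mul] at hm
      field_simp at hm
      linarith
    have h3 : ((k : ℕ) : ℤ) - ((l : ℕ) : ℤ) = n * m := by exact_mod_cast h2
    have hk := k.2
    have hl := l.2
    have hm0 : m = 0 := by
      by_contra hm0
      rcases lt_or_gt_of_ne hm0 with h | h
      · nlinarith
      · nlinarith
    rw [hm0] at h3
    exact Fin.ext (by lia)
  rw [hset, ← image_univ, ncard_image_of_injective _ hinj, ncard_univ, Nat.card_eq_fintype_card,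
    Fintype.card_fin]

theorem ncard_preimage_nCatenoidPiece (hn : 1 ≤ n) {x : EuclideanSpace ℝ (Fin 3)}
    (hx : x ∈ range (nCatenoidPiece n s)) : (nCatenoidPiece n s ⁻¹' {x}).ncard = n := by
  have hn0 : (0 : ℝ) < n := by exact_mod_cast hn
  obtain ⟨⟨t, θ⟩, rfl⟩ := hx
  have hset : nCatenoidPiece n s ⁻¹' {nCatenoidPiece n s (t, θ)} =
      (fun ψ => (t, ψ)) '' {ψ : Real.Angle | n • ψ = n • θ} := by
    ext ⟨t', ψ⟩
    constructor
    · intro h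
      obtain ⟨h1, h2⟩ := catenoid_injective (show catenoid _ _ = catenoid _ _ from h)
      have h3 := mul_left_cancel₀ hn0.ne' h1
      have h4 : t' = t := Subtype.ext (by simpa using h3)
      exact ⟨ψ, h2, Prod.ext h4.symm rfl⟩
    · rintro ⟨ψ', h, he⟩
      obtain ⟨rfl, rfl⟩ := Prod.mk.inj he
      have h' : n • ψ' = n • θ := h
      simp only [mem_preimage, mem_singleton_iff, nCatenoidPiece, nCatenoid, h']
  rw [hset, ncard_image_of_injective _ (fun a b h => congrArg Prod.snd h), ncard_nsmul_eq hn]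

end catenoid

/-! ### Coordinate functions as eigenfunctions -/

theorem coord_smul {T : ℝ} (c : ℝ) (u : Cylinder T → ℝ) (t θ : ℝ) :
    coord (c • u) t θ = c * coord u t θ := by
  unfold coord; split_ifs <;> simp

theorem IsEigenfunction.const_smul {T : ℝ} {f : ℝ → ℝ} {σ : ℝ} {u : Cylinder T → ℝ}
    (hu : IsEigenfunction f σ u) (c : ℝ) : IsEigenfunction f σ (c • u) := by
  have hc : coord (c • u) = fun t θ => c * coord u t θ := by
    funext t θ; exact coord_smul c u t θ
  have hT : ∀ F : ℝ → ℝ → ℝ, partialT T (fun t θ => c * F t θ) = fun t θ => c * partialT T F t θ :=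
    fun F => by funext t θ; exact derivWithin_const_mul_field c
  have hθ : ∀ F : ℝ → ℝ → ℝ, partialθ (fun t θ => c * F t θ) = fun t θ => c * partialθ F t θ :=
    fun F => by funext t θ; exact deriv_const_mul_field c
  refine ⟨?_, fun t ht θ => ?_, fun θ => ?_, fun θ => ?_⟩
  · unfold IsSmooth
    simp only [hc]
    exact contDiffOn_const.mul hu.smooth
  · have := hu.harmonic t ht θ
    simp only [laplacian, hc, hT, hθ] at this ⊢
    linear_combination c * this
  · have := hu.left θ
    simp only [normalDerivLeft, hc, hT] at this ⊢
    linear_combination c * this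
  · have := hu.right θ
    simp only [normalDerivRight, hc, hT] at this ⊢
    linear_combination c * this

section coordinates

variable {n : ℕ} {s : ℝ} {f : ℝ → ℝ}

/-- The indices of the Steklov eigenfunctions proportional to the coordinate functions of the
critical `n`-catenoid. -/
def coordIndex (n : ℕ) : Fin 3 → ℤ × Bool := ![(0, true), ((n : ℤ), false), (-(n : ℤ), false)]

/-- The factors of proportionality. -/
def coordScale (s : ℝ) : Fin 3 → ℝ := ![-s, Real.cosh s, -Real.cosh s]

theorem coordIndex_injective (hn : 1 ≤ n) : Function.Injective (coordIndex n) := by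
  intro i j h
  have : (n : ℤ) ≠ -n := by lia
  fin_cases i <;> fin_cases j <;> simp_all [coordIndex]

theorem coordScale_ne_zero (hs : 0 < s) (i : Fin 3) : coordScale s i ≠ 0 := by
  have := Real.cosh_pos s
  fin_cases i <;> simp [coordScale] <;> positivity

theorem range_coordIndex (n : ℕ) : range (coordIndex n) =
    {i | i = (0, true) ∨ i = ((n : ℤ), false) ∨ i = (-(n : ℤ), false)} := by
  ext i
  simp only [coordIndex, mem_range, Fin.exists_fin_succ, mem_ofPred_eq]
  simp [eq_comm]

theorem nCatenoidPiece_coordinate (hs : 1 < s) (hs2 : s ≤ 6 / 5) (hst : Real.tanh s = 1 / s)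
    (hn : 1 ≤ n) (hf : IsConformalFactor (2 * s / n) f) (hb : f 0 = f (2 * s / n)) (i : Fin 3) :
    (fun p => nCatenoidPiece n s p i) =
      coordScale s i • steklovFun (2 * s / n) f (coordIndex n i) := by
  have hn0 : (0 : ℝ) < n := by exact_mod_cast hn
  have hs0 : 0 < s := by linarith
  have hT : 0 < 2 * s / n := by positivity
  have ha := hf.pos_left hT
  have hval : steklovValue (2 * s / n) f (coordIndex n i) * f 0 = n / s := by
    have h1 := (steklovValue_critical_iff hs hs2 hst hn hf hb (coordIndex n i)).2
      (by have := mem_range_self (f := coordIndex n) i; rwa [range_coordIndex] at this)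
    rw [h1, eigenvalue_critical hs hs2 hst hn hf hb, ← hb]
    field_simp
    ring
  have hsinh : Real.sinh s = Real.cosh s / s := by
    have := Real.cosh_pos s
    rw [Real.tanh_eq_sinh_div_cosh, div_eq_div_iff this.ne' hs0.ne'] at hst
    rw [eq_div_iff hs0.ne']
    linarith
  -- Since sinh s = cosh s / s, the shifted cosine is cosh s times the radial part with σ f(0) =
  -- n/s.
  have hcosh : ∀ t : ℝ, Real.cosh (n * t - s) =
      Real.cosh s * (Real.cosh (n * t) - n / s * (Real.sinh (n * t) / n)) := by
    intro t
    rw [Real.cosh_sub, hsinh]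
    field_simp
  funext ⟨t, θ⟩
  induction θ using Real.Angle.induction_on with
  | _ x =>
    rw [nCatenoidPiece_apply hn]
    simp only [Pi.smul_apply, smul_eq_mul, steklovFun, modeFun, radial, hval]
    fin_cases i
    · simp [coordScale, coordIndex, modeCosh, modeSinh, wave_of_nonneg]
      field_simp
      ring
    · simp [coordScale, coordIndex, modeCosh, modeSinh, wave_of_nonneg, hn0.ne', hcosh]
      ring
    -- `wave (-n)` is -sin(nθ), which accounts for the minus sign in the last entry of `coordScale`.
    · have hneg : (-(n : ℤ)) < 0 := by lia
      simp [coordScale, coordIndex, modeCosh, modeSinh, wave_of_neg hneg, hn0.ne', hcosh]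
      ring

theorem isEigenfunction_coordinate (hs : 1 < s) (hs2 : s ≤ 6 / 5) (hst : Real.tanh s = 1 / s)
    (hn : 1 ≤ n) (hf : IsConformalFactor (2 * s / n) f) (hb : f 0 = f (2 * s / n)) (i : Fin 3) :
    IsEigenfunction f (eigenvalue (2 * s / n) f (2 * n - 1))
      (fun p => nCatenoidPiece n s p i) := by
  have hn0 : (0 : ℝ) < n := by exact_mod_cast hn
  rw [nCatenoidPiece_coordinate hs hs2 hst hn hf hb,
    ← (steklovValue_critical_iff hs hs2 hst hn hf hb (coordIndex n i)).2
      (by have := mem_range_self (f := coordIndex n) i; rwa [range_coordIndex] at this)]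
  exact (isEigenfunction_steklovFun (by positivity) hf _).const_smul _

theorem linearIndependent_coordinate (hs : 1 < s) (hs2 : s ≤ 6 / 5) (hst : Real.tanh s = 1 / s)
    (hn : 1 ≤ n) (hf : IsConformalFactor (2 * s / n) f) (hb : f 0 = f (2 * s / n)) :
    LinearIndependent ℝ (fun (i : Fin 3) (p : Cylinder (2 * s / n)) => nCatenoidPiece n s p i) := by
  have hn0 : (0 : ℝ) < n := by exact_mod_cast hn
  have h := ((linearIndependent_steklovFun (T := 2 * s / n) (by positivity) hf).comp _
    (coordIndex_injective hn)).units_smul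
      (fun i => Units.mk0 (coordScale s i) (coordScale_ne_zero (by linarith) i))
  convert! h using 1
  funext i
  exact nCatenoidPiece_coordinate hs hs2 hst hn hf hb i

theorem eigenSpan_critical (hs : 1 < s) (hs2 : s ≤ 6 / 5) (hst : Real.tanh s = 1 / s)
    (hn : 1 ≤ n) (hf : IsConformalFactor (2 * s / n) f) (hb : f 0 = f (2 * s / n)) :
    eigenSpan (2 * s / n) f {eigenvalue (2 * s / n) f (2 * n - 1)} =
      Submodule.span ℝ (range (fun (i : Fin 3) (p : Cylinder (2 * s / n)) =>
        nCatenoidPiece n s p i)) := by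
  have hn0 : (0 : ℝ) < n := by exact_mod_cast hn
  refine le_antisymm ?_ (Submodule.span_mono ?_)
  · rw [eigenSpan_eq (by positivity) hf, Submodule.span_le]
    rintro _ ⟨j, hj, rfl⟩
    have hj' : j ∈ range (coordIndex n) := by
      rw [range_coordIndex]
      exact (steklovValue_critical_iff hs hs2 hst hn hf hb j).1 hj
    obtain ⟨i, rfl⟩ := hj'
    have h1 : steklovFun (2 * s / n) f (coordIndex n i) =
        (coordScale s i)⁻¹ • fun p => nCatenoidPiece n s p i := by
      rw [nCatenoidPiece_coordinate hs hs2 hst hn hf hb,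
        inv_smul_smul₀ (coordScale_ne_zero (by linarith) i)]
    rw [h1]
    exact Submodule.smul_mem _ _ (Submodule.subset_span ⟨i, rfl⟩)
  · rintro _ ⟨i, rfl⟩
    exact ⟨_, rfl, isEigenfunction_coordinate hs hs2 hst hn hf hb i⟩

end coordinates

/-! ### The maximizing metrics and the main theorem -/

theorem normalizedEigenvalue_eq_iff {s : ℝ} (hs : 1 < s) (hs2 : s ≤ 6 / 5)
    (hst : Real.tanh s = 1 / s) {n : ℕ} (hn : 1 ≤ n) {T : ℝ} {f : ℝ → ℝ} (hT : 0 < T)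
    (hf : IsConformalFactor T f) :
    normalizedEigenvalue T f (2 * n - 1) = 4 * π * n / s ↔ T = 2 * s / n ∧ f 0 = f T := by
  rw [mul_div_assoc, normalizedEigenvalue_eq _ (hf.pos_left hT) (hf.pos_right hT)]
  refine ⟨fun h => (eigenvalue_le_and_eq hs hs2 hst hn hT hf h.ge).2, ?_⟩
  rintro ⟨rfl, hb⟩
  exact eigenvalue_critical hs hs2 hst hn hf hb

end Steklov

end

theorem mainTheorem2 :
    -- `s` is `T_{2,0}(1)`, the unique positive root of `s = coth s`
    ∃ s : ℝ, (0 < s ∧ s = Real.cosh s / Real.sinh s ∧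
        ∀ s' : ℝ, 0 < s' → s' = Real.cosh s' / Real.sinh s' → s' = s) ∧
      ∀ n : ℕ, 1 ≤ n →
        -- `σ_{2n-1}` is a genuine eigenvalue for every rotationally symmetric metric
        (∀ (T : ℝ) (f : ℝ → ℝ), 0 < T → Steklov.IsConformalFactor T f →
          Steklov.IsKthEigenvalue T f (2 * n - 1) (Steklov.eigenvalue T f (2 * n - 1))) ∧
        -- the maximum exists and equals `4πn / s`
        IsGreatest {x : ℝ | ∃ (T : ℝ) (f : ℝ → ℝ), 0 < T ∧ Steklov.IsConformalFactor T f ∧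
          x = Steklov.normalizedEigenvalue T f (2 * n - 1)} (4 * π * n / s) ∧
        -- the maximizing metrics
        (∀ (T : ℝ) (f : ℝ → ℝ), 0 < T → Steklov.IsConformalFactor T f →
          (Steklov.normalizedEigenvalue T f (2 * n - 1) = 4 * π * n / s ↔
            T = 2 * s / n ∧ f 0 = f T)) ∧
        -- it is attained by the metric that the critical `n`-catenoid induces
        (∃ f : ℝ → ℝ, Steklov.IsConformalFactor (2 * s / n) f ∧
          Steklov.IsInducedMetric f (Steklov.nCatenoidPiece n s) ∧
          Steklov.normalizedEigenvalue (2 * s / n) f (2 * n - 1) = 4 * π * n / s) ∧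
        -- the critical `n`-catenoid is an immersed free-boundary minimal surface in a ball
        (∃ R : ℝ, 0 < R ∧ Steklov.IsFreeBoundaryMinimal R (Steklov.nCatenoidPiece n s)) ∧
        -- it is an `n`-fold cover of the critical catenoid
        range (Steklov.nCatenoidPiece n s) =
          (fun p : ℝ × Real.Angle => Steklov.catenoid p.1 p.2) '' (Icc (-s) s ×ˢ univ) ∧
        (∀ x ∈ range (Steklov.nCatenoidPiece n s),
          (Steklov.nCatenoidPiece n s ⁻¹' {x}).ncard = n) ∧
        -- for every maximizing metric its coordinate functions are eigenfunctions of `σ_{2n-1}`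
        -- and form a basis of the eigenspace
        (∀ f : ℝ → ℝ, Steklov.IsConformalFactor (2 * s / n) f → f 0 = f (2 * s / n) →
          (∀ i : Fin 3, Steklov.IsEigenfunction f (Steklov.eigenvalue (2 * s / n) f (2 * n - 1))
            (fun p => Steklov.nCatenoidPiece n s p i)) ∧
          LinearIndependent ℝ (fun (i : Fin 3) (p : Steklov.Cylinder (2 * s / n)) =>
            Steklov.nCatenoidPiece n s p i) ∧
          Steklov.eigenSpan (2 * s / n) f {Steklov.eigenvalue (2 * s / n) f (2 * n - 1)} =
            Submodule.span ℝ (range (fun (i : Fin 3) (p : Steklov.Cylinder (2 * s / n)) =>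
              Steklov.nCatenoidPiece n s p i))) := by
  obtain ⟨s, hspec, hs, hs2, hst⟩ := Steklov.exists_coth_fixed
  have hs0 : 0 < s := hspec.1
  refine ⟨s, hspec, fun n hn => ?_⟩
  have hn0 : (0 : ℝ) < n := by exact_mod_cast hn
  have hT : 0 < 2 * s / n := by positivity
  have hcf := Steklov.isConformalFactor_catenoidFactor (s := s) hn
  have hmax : Steklov.normalizedEigenvalue (2 * s / n) (Steklov.catenoidFactor n s) (2 * n - 1) =
      4 * π * n / s :=
    (Steklov.normalizedEigenvalue_eq_iff hs hs2 hst hn hT hcf).2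
      ⟨rfl, Steklov.catenoidFactor_symm hn⟩
  refine ⟨fun T f hT hf => Steklov.isKthEigenvalue_eigenvalue hT hf _,
    ⟨⟨_, _, hT, hcf, hmax.symm⟩, ?_⟩,
    fun T f hT hf => Steklov.normalizedEigenvalue_eq_iff hs hs2 hst hn hT hf,
    ⟨_, hcf, Steklov.isInducedMetric_catenoidFactor hs0 hn, hmax⟩,
    ⟨_, by positivity, Steklov.isFreeBoundaryMinimal_nCatenoidPiece hs0 hspec.2.1 hn⟩,
    Steklov.range_nCatenoidPiece hn, fun x hx => Steklov.ncard_preimage_nCatenoidPiece hn hx,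
    fun f hf hb => ⟨Steklov.isEigenfunction_coordinate hs hs2 hst hn hf hb,
      Steklov.linearIndependent_coordinate hs hs2 hst hn hf hb,
      Steklov.eigenSpan_critical hs hs2 hst hn hf hb⟩⟩
  rintro x ⟨T, f, hT, hf, rfl⟩
  exact Steklov.normalizedEigenvalue_le hs hs2 hst hn hT hf
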